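/- Let $n\ge 1$ be an integer and $\alpha>0$. Let $$\mathcal M_\alpha=\Big\{(b_1,\dots,b_n,a_1,\dots,a_n)\in\mathbb R^n\times\mathbb R^n_{>0}\ \Big|\ \sum_{i=1}^n b_i=0,\ \prod_{i=1}^n a_i=\alpha^n\Big\},$$ a submanifold of $\mathbb R^{2n}$, and let $\omega_\alpha$ be the restriction to $\mathcal M_\alpha$ of the 2-form $2\sum_{i=2}^n\sum_{j=1}^{i-1} db_i\wedge \frac{da_j}{a_j}$. For $(b,a)\in\mathcal M_\alpha$ extend $a_k,b_k$ to all $k\in\mathbb Z$ with period $n$, and let $y_1(k,\lambda)$, $y_2(k,\lambda)$ be the solutions of $$a_{k-1}y(k-1,\lambda)+b_k y(k,\lambda)+a_k y(k+1,\lambda)=\lambda y(k,\lambda),\qquad k=1,2,\dots,$$ with $y_1(0,\lambda)=1$, $y_1(1,\lambda)=0$, $y_2(0,\lambda)=0$, $y_2(1,\lambda)=1$; they are polynomials in $\lambda$. Then $y_1(n+1,\lambda)$ has degree $n-1$ in $\lambda$ and all its roots are real. Let $\mu_1\le\dots\le\mu_{n-1}$ be these roots, listed with multiplicity (the Dirichlet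 eigenvalues). One has $y_2(n+1,\mu_i)\ne 0$ for all $i$; put $f_i=\log|y_2(n+1,\mu_i)|$, and define $$\phi_\alpha:\mathcal M_\alpha\to\mathbb R^{2n-2},\qquad \phi_\alpha(b,a)=(f_1,\dots,f_{n-1},\mu_1,\dots,\mu_{n-1}).$$ Then: 1. The image $\phi_\alpha(\mathcal M_\alpha)$ is exactly the set of all $(f_1,\dots,f_{n-1},\mu_1,\dots,\mu_{n-1})\in\mathbb R^{2n-2}$ with $\mu_1<\mu_2<\dots<\mu_{n-1}$. 2. $\phi_\alpha$ is a symplectomorphism from $(\mathcal M_\alpha,\omega_\alpha)$ onto $\big(\phi_\alpha(\mathcal M_\alpha),\ \omega_0=\sum_{i=1}^{n-1}d\mu_i\wedge df_i\big)$, i.e. a diffeomorphism onto its image with $\phi_\alpha^*\omega_0=\omega_\alpha$. 3. In particular, the 1-form $-\phi_\alpha^*\big(\sum_{i=1}^{n-1}f_i\,d\mu_i\big)$ is a primitive of $\omega_\alpha$, i.e. $d\,\phi_\alpha^*\big(\sum_{i=1}^{n-1} f_i\,d\mu_i\big)=-\omega_\alpha$. -/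

import Mathlib

open Polynomial
open scoped ContDiff

noncomputable section

/-! ### Calculus on submanifolds of a normed space -/

section Submanifold

variable {E F : Type*} [NormedAddCommGroup E] [NormedSpace ℝ E]
  [NormedAddCommGroup F] [NormedSpace ℝ F]

/-- A map is smooth on a subset `M` of a normed space if near every point of `M` it agrees on `M`
with a smooth map that is defined on an open subset of the ambient space. -/
def SmoothOnSubset (f : E → F) (M : Set E) : Prop :=
  ∀ x ∈ M, ∃ W : Set E, IsOpen W ∧ x ∈ W ∧ ∃ g : E → F, ContDiffOn ℝ ∞ g W ∧ Set.EqOn g f (W ∩ M)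

/-- Two `k`-forms, given on the ambient space, have the same restriction to `M` at `x`: they agree
on all tuples of vectors tangent to `M` at `x`. For an embedded submanifold `M`, the set
`tangentConeAt ℝ M x` is the tangent space of `M` at `x`. -/
def FormEqAt {k : ℕ} (M : Set E) (x : E) (η η' : E [⋀^Fin k]→L[ℝ] ℝ) : Prop :=
  ∀ v : Fin k → E, (∀ i, v i ∈ tangentConeAt ℝ M x) → η v = η' v

/-- The pullback `φ^* β` of a form `β` along a smooth map `φ` on `M`. The map `fderivWithin ℝ φ M x`
is a derivative of `φ` within `M`; on vectors tangent to `M` at `x`, where alone the pullback is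
used, all such derivatives agree and are the differential of `φ` restricted to `M`. -/
def pullbackForm {k : ℕ} (φ : E → F) (M : Set E) (β : F → F [⋀^Fin k]→L[ℝ] ℝ) :
    E → E [⋀^Fin k]→L[ℝ] ℝ :=
  fun x => (β (φ x)).compContinuousLinearMap (fderivWithin ℝ φ M x)

/-- `φ` is a diffeomorphism from the submanifold `M` onto the submanifold `N` with `φ^* η = σ`
on `M`. -/
structure IsSymplectomorphismOn (φ : E → F) (M : Set E) (σ : E → E [⋀^Fin 2]→L[ℝ] ℝ)
    (N : Set F) (η : F → F [⋀^Fin 2]→L[ℝ] ℝ) : Prop where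
  bijOn : Set.BijOn φ M N
  smooth : SmoothOnSubset φ M
  smooth_inverse : ∃ ψ : F → E, Set.InvOn ψ φ M N ∧ SmoothOnSubset ψ N
  pullback_eq : ∀ x ∈ M, FormEqAt M x (pullbackForm φ M η x) (σ x)

/-- `θ` is a primitive of `η` on the submanifold `M`, that is `dθ = η` on `M`: near each point of
`M`, the form `θ` on `M` is the restriction of a smooth form `Θ` on an open subset of the ambient
space, and `η` is the restriction of `dΘ`. -/
def IsPrimitiveOn {k : ℕ} (M : Set E) (θ : E → E [⋀^Fin k]→L[ℝ] ℝ)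
    (η : E → E [⋀^Fin (k + 1)]→L[ℝ] ℝ) : Prop :=
  ∀ x ∈ M, ∃ W : Set E, IsOpen W ∧ x ∈ W ∧ ∃ Θ : E → E [⋀^Fin k]→L[ℝ] ℝ,
    ContDiffOn ℝ ∞ Θ W ∧
    (∀ y ∈ W ∩ M, FormEqAt M y (Θ y) (θ y)) ∧
    (∀ y ∈ W ∩ M, FormEqAt M y (extDeriv Θ y) (η y))

/-- A continuous linear functional as an alternating `1`-form. -/
def oneForm (l : E →L[ℝ] ℝ) : E [⋀^Fin 1]→L[ℝ] ℝ :=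
  ContinuousAlternatingMap.ofSubsingleton ℝ E ℝ (0 : Fin 1) l

/-- The wedge product `l ∧ m` of two linear functionals,
`(l ∧ m)(u, v) = l(u) m(v) - l(v) m(u)`. -/
def wedge (l m : E →L[ℝ] ℝ) : E [⋀^Fin 2]→L[ℝ] ℝ :=
  ContinuousMultilinearMap.alternatization
    ((ContinuousMultilinearMap.mkPiAlgebra ℝ (Fin 2) ℝ).compContinuousLinearMap ![l, m])

theorem oneForm_apply (l : E →L[ℝ] ℝ) (v : Fin 1 → E) : oneForm l v = l (v 0) := rfl

theorem wedge_apply (l m : E →L[ℝ] ℝ) (v : Fin 2 → E) :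
    wedge l m v = l (v 0) * m (v 1) - l (v 1) * m (v 0) := by
  have h : (Finset.univ : Finset (Equiv.Perm (Fin 2))) = {1, Equiv.swap 0 1} := by decide
  have h1 : (1 : Equiv.Perm (Fin 2)) ∉ ({Equiv.swap 0 1} : Finset (Equiv.Perm (Fin 2))) := by decide
  rw [wedge, ContinuousMultilinearMap.alternatization_apply_apply, h, Finset.sum_insert h1,
    Finset.sum_singleton]
  simp [Fin.prod_univ_two]
  ring

end Submanifold

/-! ### The periodic Toda lattice in Flaschka variables -/

namespace Toda

/-- The space of pairs `x = (b, a)` with `b, a` real and indexed modulo `n`; thus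
`b_k = x.1 (k : ZMod n)` and `a_k = x.2 (k : ZMod n)` for every integer `k`, and `a_0 = a_n`. -/
abbrev Flaschka (n : ℕ) : Type := (ZMod n → ℝ) × (ZMod n → ℝ)

/-- The space of pairs `z = (f, μ)` with `f, μ ∈ ℝ^(n-1)`; here `f_i = z.1 (i - 1)` and
`μ_i = z.2 (i - 1)` for `1 ≤ i ≤ n - 1`. -/
abbrev Target (n : ℕ) : Type := (Fin (n - 1) → ℝ) × (Fin (n - 1) → ℝ)

variable {n : ℕ}

/-- The solution `y(k, λ)`, a polynomial in `λ`, of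
`a_{k-1} y(k-1, λ) + b_k y(k, λ) + a_k y(k+1, λ) = λ y(k, λ)` for `k = 1, 2, …`,
with initial values `y(0, λ) = s₀` and `y(1, λ) = s₁`. -/
def solution (x : Flaschka n) (s₀ s₁ : ℝ) : ℕ → ℝ[X]
  | 0 => C s₀
  | 1 => C s₁
  | k + 2 => C (x.2 ((k + 1 : ℕ) : ZMod n))⁻¹ *
      ((X - C (x.1 ((k + 1 : ℕ) : ZMod n))) * solution x s₀ s₁ (k + 1)
        - C (x.2 ((k : ℕ) : ZMod n)) * solution x s₀ s₁ k)

/-- The fundamental solution with `y₁(0, λ) = 1` and `y₁(1, λ) = 0`. -/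
def y₁ (x : Flaschka n) (k : ℕ) : ℝ[X] := solution x 1 0 k

/-- The fundamental solution with `y₂(0, λ) = 0` and `y₂(1, λ) = 1`. -/
def y₂ (x : Flaschka n) (k : ℕ) : ℝ[X] := solution x 0 1 k

/-- The Dirichlet eigenvalues `μ_1 ≤ … ≤ μ_{n-1}`: the roots of `y₁(n+1, λ)`, with multiplicity,
in increasing order. The default value `0` of `getD` is not used when there are `n - 1` roots. -/
def dirichlet (x : Flaschka n) (i : Fin (n - 1)) : ℝ :=
  ((y₁ x (n + 1)).roots.sort (fun s t => s ≤ t)).getD i 0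

/-- The map sending `(b, a)` to `(f, μ)`, where `f_i = log |y₂(n+1, μ_i)|`. -/
def floquetMap (x : Flaschka n) : Target n :=
  (fun i => Real.log |(y₂ x (n + 1)).eval (dirichlet x i)|, dirichlet x)

/-- The coordinate function `b_k` as a linear functional, hence the `1`-form `db_k`. -/
def db (n : ℕ) (k : ZMod n) : Flaschka n →L[ℝ] ℝ :=
  (ContinuousLinearMap.proj k).comp (ContinuousLinearMap.fst ℝ (ZMod n → ℝ) (ZMod n → ℝ))

/-- The `1`-form `da_k`. -/
def da (n : ℕ) (k : ZMod n) : Flaschka n →L[ℝ] ℝ :=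
  (ContinuousLinearMap.proj k).comp (ContinuousLinearMap.snd ℝ (ZMod n → ℝ) (ZMod n → ℝ))

/-- The `1`-form `df_i`. -/
def df (n : ℕ) (i : Fin (n - 1)) : Target n →L[ℝ] ℝ :=
  (ContinuousLinearMap.proj i).comp (ContinuousLinearMap.fst ℝ (Fin (n - 1) → ℝ) (Fin (n - 1) → ℝ))

/-- The `1`-form `dμ_i`. -/
def dμ (n : ℕ) (i : Fin (n - 1)) : Target n →L[ℝ] ℝ :=
  (ContinuousLinearMap.proj i).comp (ContinuousLinearMap.snd ℝ (Fin (n - 1) → ℝ) (Fin (n - 1) → ℝ))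

/-- The phase space `𝓜_α`: all `(b, a)` with `a_i > 0`, `∑ b_i = 0` and `∏ a_i = α^n`. -/
def phaseSpace (n : ℕ) [NeZero n] (α : ℝ) : Set (Flaschka n) :=
  {x | (∀ i, 0 < x.2 i) ∧ ∑ i, x.1 i = 0 ∧ ∏ i, x.2 i = α ^ n}

/-- The `2`-form `2 ∑_{i=2}^n ∑_{j=1}^{i-1} db_i ∧ da_j / a_j`, whose restriction to `𝓜_α` is the
symplectic form `ω_α`. -/
def todaForm (n : ℕ) [NeZero n] (x : Flaschka n) : Flaschka n [⋀^Fin 2]→L[ℝ] ℝ :=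
  (2 : ℝ) • ∑ i ∈ Finset.Icc 2 n, ∑ j ∈ Finset.Icc 1 (i - 1),
    wedge (db n (i : ZMod n)) ((x.2 (j : ZMod n))⁻¹ • da n (j : ZMod n))

/-- The standard symplectic form `ω₀ = ∑ dμ_i ∧ df_i` on the space of all `(f, μ)`. -/
def stdForm (n : ℕ) (_z : Target n) : Target n [⋀^Fin 2]→L[ℝ] ℝ :=
  ∑ i, wedge (dμ n i) (df n i)

/-- The `1`-form `∑ f_i dμ_i` on the space of all `(f, μ)`. -/
def actionForm (n : ℕ) (z : Target n) : Target n [⋀^Fin 1]→L[ℝ] ℝ :=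
  oneForm (∑ i, z.1 i • dμ n i)

end Toda

end

/-!
Up to a constant, `y₁(n+1, ·)` is the characteristic polynomial `p_{n-1}` of the Jacobi matrix with
diagonal `b_2, …, b_n` and off-diagonal `a_2, …, a_{n-1}`, and `y₁(n, ·) = -c p_{n-2}` with
`c = a_n / (a_1 ⋯ a_{n-1})`, where `p_{n-2}` belongs to the block without its last row and column.
The zeros `μ_i` of `p_{n-1}` are therefore real and simple and separated by those of `p_{n-2}`, and
the constancy of the Wronskian gives `y₂(n+1, μ_i) = 1 / y₁(n, μ_i)`, that is
`f_i = -log (c |p_{n-2}(μ_i)|)`.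

The data `(f, μ)` fix `p_{n-1}` and the values of `c p_{n-2}` at its zeros, and the three-term
recurrence recovers the matrix from `p_{n-1}` and `p_{n-2}`. Conversely, for increasing `μ` the
matrix is read off from the orthogonal polynomials of the measure with masses
`e^{f_i} / |p_{n-1}'(μ_i)|` at `μ_i`, which depend smoothly on `(f, μ)`.

On a pair of tangent vectors, `∑ dμ_i ∧ df_i` is an elementary term coming from `d log c` plus a sum
of residues at the zeros of `p_{n-1}`. The residue theorem turns the latter into the same sum at the
zeros of `p_{n-2}`, so that it is evaluated recursively down to the empty matrix; with
`d ∑ log a_i = 0` on the phase space and a summation by parts, the total is the Toda form.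
-/

/-! ### Characteristic polynomials of Jacobi matrices -/

/-- The monic polynomials `p_0 = 1`, `p_1 = X - β_0`,
`p_{k+2} = (X - β_{k+1}) p_{k+1} - γ_k p_k`: the characteristic polynomials of the leading blocks
of a Jacobi matrix with diagonal entries `β` and squared off-diagonal entries `γ`. -/
noncomputable def jacobiPoly {R : Type*} [CommRing R] (β γ : ℕ → R) : ℕ → R[X]
  | 0 => 1
  | 1 => X - C (β 0)
  | k + 2 => (X - C (β (k + 1))) * jacobiPoly β γ (k + 1) - C (γ k) * jacobiPoly β γ k

section JacobiPoly

variable {R : Type*} [CommRing R] {β γ β' γ' : ℕ → R}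

theorem jacobiPoly_add_two (k : ℕ) : jacobiPoly β γ (k + 2) =
    (X - C (β (k + 1))) * jacobiPoly β γ (k + 1) - C (γ k) * jacobiPoly β γ k := rfl

theorem coeff_jacobiPoly_of_lt {k j : ℕ} (hkj : k < j) : (jacobiPoly β γ k).coeff j = 0 := by
  induction k using Nat.twoStepInduction generalizing j with
  | zero => simp [jacobiPoly, coeff_one, hkj.ne']
  | one => simp [jacobiPoly, coeff_X, coeff_C, hkj.ne, (Nat.zero_lt_of_lt hkj).ne']
  | more k h0 h1 =>
    obtain ⟨j, rfl⟩ : ∃ i, j = i + 1 := ⟨j - 1, by omega⟩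
    simp [jacobiPoly_add_two, sub_mul, coeff_X_mul, coeff_C_mul, h0 (j := j + 1) (by omega),
      h1 (j := j) (by omega), h1 (j := j + 1) (by omega)]

theorem coeff_jacobiPoly_self (k : ℕ) : (jacobiPoly β γ k).coeff k = 1 := by
  induction k using Nat.twoStepInduction with
  | zero => simp [jacobiPoly]
  | one => simp [jacobiPoly, coeff_X]
  | more k _ h1 =>
    simp [jacobiPoly_add_two, sub_mul, coeff_X_mul, coeff_C_mul, h1,
      coeff_jacobiPoly_of_lt (show k < k + 2 by omega), coeff_jacobiPoly_of_lt (k + 1).lt_succ_self]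

theorem natDegree_jacobiPoly_le (k : ℕ) : (jacobiPoly β γ k).natDegree ≤ k :=
  natDegree_le_iff_coeff_eq_zero.2 fun _ => coeff_jacobiPoly_of_lt

theorem monic_jacobiPoly (k : ℕ) : (jacobiPoly β γ k).Monic :=
  monic_of_natDegree_le_of_coeff_eq_one k (natDegree_jacobiPoly_le k) (coeff_jacobiPoly_self k)

theorem natDegree_jacobiPoly [Nontrivial R] (k : ℕ) : (jacobiPoly β γ k).natDegree = k :=
  natDegree_eq_of_le_of_coeff_ne_zero (natDegree_jacobiPoly_le k)
    (by rw [coeff_jacobiPoly_self]; exact one_ne_zero)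

theorem jacobiPoly_congr {m : ℕ} (hβ : ∀ k < m, β k = β' k) (hγ : ∀ k, k + 1 < m → γ k = γ' k) :
    jacobiPoly β γ m = jacobiPoly β' γ' m := by
  induction m using Nat.twoStepInduction with
  | zero => rfl
  | one => rw [jacobiPoly, jacobiPoly, hβ 0 one_pos]
  | more k h0 h1 =>
    rw [jacobiPoly_add_two, jacobiPoly_add_two, hβ (k + 1) (by omega), hγ k (by omega),
      h0 (fun j hj => hβ j (by omega)) fun j hj => hγ j (by omega),
      h1 (fun j hj => hβ j (by omega)) fun j hj => hγ j (by omega)]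

theorem jacobiPoly_diag_eq {k : ℕ} (h0 : jacobiPoly β γ k = jacobiPoly β' γ' k)
    (h1 : jacobiPoly β γ (k + 1) = jacobiPoly β' γ' (k + 1)) : β k = β' k := by
  rcases k with _ | k
  · simpa [jacobiPoly] using h1
  have h := congrArg (coeff · (k + 1)) h1
  simp only [jacobiPoly_add_two, h0, sub_mul, coeff_sub, coeff_X_mul, coeff_C_mul,
    coeff_jacobiPoly_self, coeff_jacobiPoly_of_lt k.lt_succ_self] at h
  linear_combination -h

theorem jacobiPoly_offDiag_eq [IsDomain R] {k : ℕ} (hγ : γ k ≠ 0)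
    (h1 : jacobiPoly β γ (k + 1) = jacobiPoly β' γ' (k + 1))
    (h2 : jacobiPoly β γ (k + 2) = jacobiPoly β' γ' (k + 2)) :
    γ k = γ' k ∧ jacobiPoly β γ k = jacobiPoly β' γ' k := by
  have hp : C (γ k) * jacobiPoly β γ k = C (γ' k) * jacobiPoly β' γ' k := by
    have hβ := jacobiPoly_diag_eq h1 h2
    rw [jacobiPoly_add_two, jacobiPoly_add_two, ← h1, hβ] at h2
    exact sub_right_injective h2
  have hc : γ k = γ' k := by
    simpa only [coeff_C_mul, coeff_jacobiPoly_self, mul_one] using congrArg (coeff · k) hp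
  rw [← hc] at hp
  exact ⟨hc, mul_left_cancel₀ (C_ne_zero.2 hγ) hp⟩

theorem jacobiPoly_unique [IsDomain R] (hγ : ∀ k, γ k ≠ 0) {k : ℕ}
    (h0 : jacobiPoly β γ k = jacobiPoly β' γ' k)
    (h1 : jacobiPoly β γ (k + 1) = jacobiPoly β' γ' (k + 1)) :
    (∀ j ≤ k, β j = β' j) ∧ ∀ j < k, γ j = γ' j := by
  induction k with
  | zero => simpa using jacobiPoly_diag_eq h0 h1
  | succ k ih =>
    obtain ⟨hk, hp⟩ := jacobiPoly_offDiag_eq (hγ k) h0 h1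
    obtain ⟨hβ, hγ'⟩ := ih hp h0
    refine ⟨fun j hj => ?_, Nat.forall_lt_succ_right.2 ⟨hγ', hk⟩⟩
    rcases Nat.le_succ_iff.1 hj with hj | rfl
    exacts [hβ j hj, jacobiPoly_diag_eq h0 h1]

section Ordered

variable [LinearOrder R] [IsStrictOrderedRing R]

/-- The Wronskian is the confluent Christoffel–Darboux sum `∑_{j ≤ k} γ_j ⋯ γ_{k-1} p_j(x)²`. -/
theorem jacobiPoly_wronskian_pos (hγ : ∀ k, 0 < γ k) (k : ℕ) (x : R) :
    0 < (derivative (jacobiPoly β γ (k + 1))).eval x * (jacobiPoly β γ k).eval x -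
      (jacobiPoly β γ (k + 1)).eval x * (derivative (jacobiPoly β γ k)).eval x := by
  induction k with
  | zero => simp [jacobiPoly]
  | succ k ih =>
    have hrec : (derivative (jacobiPoly β γ (k + 2))).eval x * (jacobiPoly β γ (k + 1)).eval x -
        (jacobiPoly β γ (k + 2)).eval x * (derivative (jacobiPoly β γ (k + 1))).eval x =
        (jacobiPoly β γ (k + 1)).eval x ^ 2 +
          γ k * ((derivative (jacobiPoly β γ (k + 1))).eval x * (jacobiPoly β γ k).eval x -
            (jacobiPoly β γ (k + 1)).eval x * (derivative (jacobiPoly β γ k)).eval x) := by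
      simp only [jacobiPoly_add_two, derivative_sub, derivative_mul, derivative_X, derivative_C,
        eval_sub, eval_mul, eval_add, eval_X, eval_C, eval_one, eval_zero]
      ring
    rw [hrec]
    exact add_pos_of_nonneg_of_pos (sq_nonneg _) (mul_pos (hγ k) ih)

theorem jacobiPoly_derivative_mul_pos (hγ : ∀ k, 0 < γ k) {k : ℕ} {x : R}
    (hx : (jacobiPoly β γ (k + 1)).eval x = 0) :
    0 < (derivative (jacobiPoly β γ (k + 1))).eval x * (jacobiPoly β γ k).eval x := by
  simpa only [hx, zero_mul, sub_zero] using jacobiPoly_wronskian_pos (β := β) hγ k x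

theorem nodup_roots_jacobiPoly (hγ : ∀ k, 0 < γ k) (k : ℕ) : (jacobiPoly β γ k).roots.Nodup := by
  classical
  rcases k with _ | k
  · simp [jacobiPoly]
  rw [Multiset.nodup_iff_count_le_one]
  intro a
  rw [count_roots]
  by_contra! h
  rw [one_lt_rootMultiplicity_iff_isRoot (monic_jacobiPoly _).ne_zero] at h
  have hpos := jacobiPoly_derivative_mul_pos hγ h.1
  rw [h.2.eq_zero, zero_mul] at hpos
  exact hpos.false

end Ordered

end JacobiPoly

section RealJacobiPoly

variable {β γ : ℕ → ℝ}

/-- The left-hand factor and the imaginary part multiply to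
`(Im z)² ∑_{j ≤ k} γ_j ⋯ γ_{k-1} |p_j(z)|²`, so `p_{k+1}` has no zero off the real line. -/
theorem jacobiPoly_im_pos (hγ : ∀ k, 0 < γ k) (k : ℕ) {z : ℂ} (hz : z.im ≠ 0) :
    0 < z.im * (aeval z (jacobiPoly β γ (k + 1)) *
      (starRingEnd ℂ) (aeval z (jacobiPoly β γ k))).im := by
  induction k with
  | zero =>
    simp only [jacobiPoly, map_sub, aeval_X, aeval_C, map_one, mul_one, Complex.sub_im,
      Complex.coe_algebraMap, Complex.ofReal_im, sub_zero]
    exact mul_self_pos.2 hz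
  | succ k ih =>
    have hrec : z.im * (aeval z (jacobiPoly β γ (k + 2)) *
        (starRingEnd ℂ) (aeval z (jacobiPoly β γ (k + 1)))).im =
        z.im ^ 2 * Complex.normSq (aeval z (jacobiPoly β γ (k + 1))) +
          γ k * (z.im * (aeval z (jacobiPoly β γ (k + 1)) *
            (starRingEnd ℂ) (aeval z (jacobiPoly β γ k))).im) := by
      simp only [jacobiPoly_add_two, map_sub, map_mul, aeval_X, aeval_C, Complex.coe_algebraMap,
        Complex.normSq_apply, Complex.mul_im, Complex.mul_re, Complex.sub_re, Complex.sub_im,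
        Complex.ofReal_re, Complex.ofReal_im, Complex.conj_re, Complex.conj_im]
      ring
    rw [hrec]
    exact add_pos_of_nonneg_of_pos (mul_nonneg (sq_nonneg _) (Complex.normSq_nonneg _))
      (mul_pos (hγ k) ih)

theorem jacobiPoly_splits (hγ : ∀ k, 0 < γ k) (k : ℕ) : (jacobiPoly β γ k).Splits := by
  rcases k with _ | k
  · simp [jacobiPoly]
  refine Splits.of_splits_map (algebraMap ℝ ℂ) (IsAlgClosed.splits _) fun z hz => ?_
  have him : z.im = 0 := by
    by_contra h
    have hpos := jacobiPoly_im_pos (β := β) hγ k h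
    rw [mem_roots_map (monic_jacobiPoly _).ne_zero, ← aeval_def] at hz
    simp [hz] at hpos
  exact ⟨z.re, Complex.ext rfl him.symm⟩

/-- The set of real zeros of `jacobiPoly β γ k`. -/
noncomputable def jacobiRoots (β γ : ℕ → ℝ) (k : ℕ) : Finset ℝ :=
  (jacobiPoly β γ k).roots.toFinset

theorem mem_jacobiRoots {k : ℕ} {r : ℝ} :
    r ∈ jacobiRoots β γ k ↔ (jacobiPoly β γ k).eval r = 0 := by
  rw [jacobiRoots, Multiset.mem_toFinset, mem_roots (monic_jacobiPoly k).ne_zero, IsRoot]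

theorem nodal_jacobiRoots (hγ : ∀ k, 0 < γ k) (k : ℕ) :
    Lagrange.nodal (jacobiRoots β γ k) id = jacobiPoly β γ k := by
  rw [(jacobiPoly_splits hγ k).eq_prod_roots, (monic_jacobiPoly k).leadingCoeff, C_1, one_mul,
    Lagrange.nodal, jacobiRoots, Finset.prod, Multiset.toFinset_val,
    (nodup_roots_jacobiPoly hγ k).dedup]
  rfl

theorem card_jacobiRoots (hγ : ∀ k, 0 < γ k) (k : ℕ) : (jacobiRoots β γ k).card = k := by
  rw [← Lagrange.natDegree_nodal (v := (id : ℝ → ℝ)), nodal_jacobiRoots hγ, natDegree_jacobiPoly]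

theorem disjoint_jacobiRoots (hγ : ∀ k, 0 < γ k) (k : ℕ) :
    Disjoint (jacobiRoots β γ (k + 1)) (jacobiRoots β γ k) := by
  rw [Finset.disjoint_left]
  intro r h1 h0
  exact right_ne_zero_of_mul (jacobiPoly_derivative_mul_pos hγ (mem_jacobiRoots.1 h1)).ne'
    (mem_jacobiRoots.1 h0)

end RealJacobiPoly

/-! ### Residue sums -/

section Residues

variable {K : Type*} [Field K]

theorem sum_eval_div_eval_derivative_nodal {s : Finset K} {q : K[X]} (hq : q.degree < s.card) :
    ∑ r ∈ s, q.eval r / (derivative (Lagrange.nodal s id)).eval r = q.coeff (s.card - 1) := by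
  classical
  rw [Lagrange.coeff_eq_sum (v := id) (s := s) (Set.injOn_id _) hq]
  refine Finset.sum_congr rfl fun r hr => ?_
  have hder := Lagrange.eval_nodal_derivative_eval_node_eq (v := (id : K → K)) hr
  rw [id] at hder
  rw [hder, Lagrange.eval_nodal]
  rfl

/-- The residue theorem for `w / (N_s N_t)`, where `N_s` and `N_t` are the monic polynomials with
zero sets `s` and `t`: the degree bound makes the residue at infinity vanish. -/
theorem sum_residues_eq_zero {s t : Finset K} (hst : Disjoint s t) {w : K[X]}
    (hw : w.natDegree + 2 ≤ s.card + t.card) :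
    ∑ r ∈ s, w.eval r / ((derivative (Lagrange.nodal s id)).eval r * (Lagrange.nodal t id).eval r) +
      ∑ r ∈ t, w.eval r /
        ((Lagrange.nodal s id).eval r * (derivative (Lagrange.nodal t id)).eval r) = 0 := by
  classical
  have hcard : (s ∪ t).card = s.card + t.card := Finset.card_union_of_disjoint hst
  have hnodal : Lagrange.nodal (s ∪ t) (id : K → K) =
      Lagrange.nodal s id * Lagrange.nodal t id := Finset.prod_union hst
  have hsum := sum_eval_div_eval_derivative_nodal (s := s ∪ t) (q := w)
    (degree_le_natDegree.trans_lt (by rw [hcard]; exact_mod_cast (by omega)))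
  rw [coeff_eq_zero_of_natDegree_lt (by omega), Finset.sum_union hst, hnodal] at hsum
  rw [← hsum]
  congr 1 <;> refine Finset.sum_congr rfl fun r hr => ?_ <;>
    have hroot := Lagrange.eval_nodal_at_node (v := (id : K → K)) hr <;>
    rw [id] at hroot <;> simp [derivative_mul, hroot]

end Residues

/-- The derivative of `jacobiPoly β γ k` along variations `β'` of `β` and `γ'` of `γ`. -/
noncomputable def jacobiVar {R : Type*} [CommRing R] (β γ β' γ' : ℕ → R) : ℕ → R[X]
  | 0 => 0
  | 1 => -C (β' 0)
  | k + 2 => (X - C (β (k + 1))) * jacobiVar β γ β' γ' (k + 1)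
      - C (β' (k + 1)) * jacobiPoly β γ (k + 1)
      - C (γ k) * jacobiVar β γ β' γ' k - C (γ' k) * jacobiPoly β γ k

/-- The determinant `p'_{k+1} p''_k - p''_{k+1} p'_k` of two variations `p'`, `p''` of consecutive
polynomials `p_{k+1}`, `p_k`. -/
noncomputable def jacobiVarDet {R : Type*} [CommRing R] (β γ β₁ γ₁ β₂ γ₂ : ℕ → R) (k : ℕ) : R[X] :=
  jacobiVar β γ β₁ γ₁ (k + 1) * jacobiVar β γ β₂ γ₂ k -
    jacobiVar β γ β₂ γ₂ (k + 1) * jacobiVar β γ β₁ γ₁ k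

section JacobiVar

variable {R : Type*} [CommRing R] {β γ β' γ' β₁ γ₁ β₂ γ₂ : ℕ → R}

theorem jacobiVar_add_two (k : ℕ) : jacobiVar β γ β' γ' (k + 2) =
    (X - C (β (k + 1))) * jacobiVar β γ β' γ' (k + 1)
      - C (β' (k + 1)) * jacobiPoly β γ (k + 1)
      - C (γ k) * jacobiVar β γ β' γ' k - C (γ' k) * jacobiPoly β γ k := rfl

theorem coeff_jacobiVar_of_le {k j : ℕ} (hkj : k ≤ j) : (jacobiVar β γ β' γ' k).coeff j = 0 := by
  induction k using Nat.twoStepInduction generalizing j with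
  | zero => simp [jacobiVar]
  | one => simp [jacobiVar, coeff_C, (Nat.zero_lt_of_lt hkj).ne']
  | more k h0 h1 =>
    obtain ⟨j, rfl⟩ : ∃ i, j = i + 1 := ⟨j - 1, by omega⟩
    simp [jacobiVar_add_two, sub_mul, coeff_X_mul, coeff_C_mul, h0 (j := j + 1) (by omega),
      h1 (j := j) (by omega), h1 (j := j + 1) (by omega),
      coeff_jacobiPoly_of_lt (show k < j + 1 by omega),
      coeff_jacobiPoly_of_lt (show k + 1 < j + 1 by omega)]

theorem coeff_jacobiVar_succ (k : ℕ) :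
    (jacobiVar β γ β' γ' (k + 1)).coeff k = -∑ j ∈ Finset.range (k + 1), β' j := by
  induction k with
  | zero => simp [jacobiVar]
  | succ k ih =>
    rw [jacobiVar_add_two, Finset.sum_range_succ]
    simp only [sub_mul, coeff_sub, coeff_X_mul, coeff_C_mul, ih, coeff_jacobiPoly_self,
      coeff_jacobiVar_of_le (Nat.le_succ k), coeff_jacobiVar_of_le (le_refl (k + 1)),
      coeff_jacobiPoly_of_lt k.lt_succ_self]
    ring

theorem natDegree_jacobiVar_succ_le (k : ℕ) : (jacobiVar β γ β' γ' (k + 1)).natDegree ≤ k :=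
  natDegree_le_iff_coeff_eq_zero.2 fun _ => coeff_jacobiVar_of_le

theorem natDegree_jacobiVarDet_succ_le (k : ℕ) :
    (jacobiVarDet β γ β₁ γ₁ β₂ γ₂ (k + 1)).natDegree ≤ k + 1 + k := by
  have hmul (δ₁ ε₁ δ₂ ε₂ : ℕ → R) :
      (jacobiVar β γ δ₁ ε₁ (k + 2) * jacobiVar β γ δ₂ ε₂ (k + 1)).natDegree ≤ k + 1 + k :=
    natDegree_mul_le_of_le (natDegree_jacobiVar_succ_le _) (natDegree_jacobiVar_succ_le _)
  exact (natDegree_sub_le_of_le (hmul ..) (hmul ..)).trans (max_self _).le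

theorem eval_jacobiVarDet_succ {k : ℕ} {r : R} (hr : (jacobiPoly β γ (k + 1)).eval r = 0) :
    (jacobiVarDet β γ β₁ γ₁ β₂ γ₂ (k + 1)).eval r =
      γ k * (jacobiVarDet β γ β₁ γ₁ β₂ γ₂ k).eval r -
        (jacobiPoly β γ k).eval r * (γ₁ k * (jacobiVar β γ β₂ γ₂ (k + 1)).eval r -
          γ₂ k * (jacobiVar β γ β₁ γ₁ (k + 1)).eval r) := by
  simp only [jacobiVarDet, jacobiVar_add_two, eval_sub, eval_mul, eval_X, eval_C, hr]
  ring

end JacobiVar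

section ResidueSum

variable {β γ β₁ γ₁ β₂ γ₂ : ℕ → ℝ}

theorem sum_jacobiVar_div (hγ : ∀ k, 0 < γ k) (k : ℕ) :
    ∑ r ∈ jacobiRoots β γ (k + 1), (jacobiVar β γ β₁ γ₁ (k + 1)).eval r /
      (derivative (jacobiPoly β γ (k + 1))).eval r = -∑ j ∈ Finset.range (k + 1), β₁ j := by
  have hdeg : (jacobiVar β γ β₁ γ₁ (k + 1)).degree < (jacobiRoots β γ (k + 1)).card := by
    rw [card_jacobiRoots hγ]
    exact degree_le_natDegree.trans_lt
      (by exact_mod_cast Nat.lt_succ_of_le (natDegree_jacobiVar_succ_le k))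
  have hsum := sum_eval_div_eval_derivative_nodal hdeg
  rwa [nodal_jacobiRoots hγ, card_jacobiRoots hγ, Nat.add_sub_cancel, coeff_jacobiVar_succ] at hsum

/-- The sum over the zeros of `p_{k+1}` of the residues of
`(p'_{k+1} p''_k - p''_{k+1} p'_k) / (p_{k+1} p_k)`. At the zeros `μ_i` of `p_{k+1}` this evaluates
`∑ dμ_i ∧ d log |p_k(μ_i)|`, up to sign, on the two variations. -/
noncomputable def residueSum (β γ β₁ γ₁ β₂ γ₂ : ℕ → ℝ) (k : ℕ) : ℝ :=
  ∑ r ∈ jacobiRoots β γ (k + 1), (jacobiVarDet β γ β₁ γ₁ β₂ γ₂ k).eval r /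
    ((derivative (jacobiPoly β γ (k + 1))).eval r * (jacobiPoly β γ k).eval r)

theorem sum_jacobiVarDet_succ_div (hγ : ∀ k, 0 < γ k) (k : ℕ) :
    ∑ r ∈ jacobiRoots β γ (k + 1), (jacobiVarDet β γ β₁ γ₁ β₂ γ₂ (k + 1)).eval r /
        ((jacobiPoly β γ (k + 2)).eval r * (derivative (jacobiPoly β γ (k + 1))).eval r) =
      -residueSum β γ β₁ γ₁ β₂ γ₂ k -
        (γ₁ k / γ k * ∑ j ∈ Finset.range (k + 1), β₂ j -
          γ₂ k / γ k * ∑ j ∈ Finset.range (k + 1), β₁ j) := by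
  have hterm : ∀ r ∈ jacobiRoots β γ (k + 1), (jacobiVarDet β γ β₁ γ₁ β₂ γ₂ (k + 1)).eval r /
        ((jacobiPoly β γ (k + 2)).eval r * (derivative (jacobiPoly β γ (k + 1))).eval r) =
      -((jacobiVarDet β γ β₁ γ₁ β₂ γ₂ k).eval r /
          ((derivative (jacobiPoly β γ (k + 1))).eval r * (jacobiPoly β γ k).eval r)) +
        (γ₁ k / γ k * ((jacobiVar β γ β₂ γ₂ (k + 1)).eval r /
            (derivative (jacobiPoly β γ (k + 1))).eval r) -
          γ₂ k / γ k * ((jacobiVar β γ β₁ γ₁ (k + 1)).eval r /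
            (derivative (jacobiPoly β γ (k + 1))).eval r)) := by
    intro r hr
    rw [mem_jacobiRoots] at hr
    have hpos := jacobiPoly_derivative_mul_pos hγ hr
    have hd := left_ne_zero_of_mul hpos.ne'
    have hp := right_ne_zero_of_mul hpos.ne'
    have hg := (hγ k).ne'
    simp only [eval_jacobiVarDet_succ hr, jacobiPoly_add_two, eval_sub, eval_mul, eval_C, hr]
    field_simp
    ring
  rw [Finset.sum_congr rfl hterm, Finset.sum_add_distrib, Finset.sum_sub_distrib,
    Finset.sum_neg_distrib, ← Finset.mul_sum, ← Finset.mul_sum, sum_jacobiVar_div hγ,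
    sum_jacobiVar_div hγ, residueSum]
  ring

theorem residueSum_succ (hγ : ∀ k, 0 < γ k) (k : ℕ) :
    residueSum β γ β₁ γ₁ β₂ γ₂ (k + 1) = residueSum β γ β₁ γ₁ β₂ γ₂ k +
      (γ₁ k / γ k * ∑ j ∈ Finset.range (k + 1), β₂ j -
        γ₂ k / γ k * ∑ j ∈ Finset.range (k + 1), β₁ j) := by
  have hres := sum_residues_eq_zero (disjoint_jacobiRoots (β := β) hγ (k + 1))
    (w := jacobiVarDet β γ β₁ γ₁ β₂ γ₂ (k + 1)) (by
      rw [card_jacobiRoots hγ, card_jacobiRoots hγ]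
      exact (Nat.add_le_add_right (natDegree_jacobiVarDet_succ_le k) 2).trans (by omega))
  rw [nodal_jacobiRoots hγ, nodal_jacobiRoots hγ, sum_jacobiVarDet_succ_div hγ] at hres
  rw [residueSum]
  linear_combination hres

theorem residueSum_eq (hγ : ∀ k, 0 < γ k) (k : ℕ) :
    residueSum β γ β₁ γ₁ β₂ γ₂ k = ∑ i ∈ Finset.range k,
      (γ₁ i / γ i * ∑ j ∈ Finset.range (i + 1), β₂ j -
        γ₂ i / γ i * ∑ j ∈ Finset.range (i + 1), β₁ j) := by
  induction k with
  | zero => simp [residueSum, jacobiVarDet, jacobiVar]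
  | succ k ih => rw [residueSum_succ hγ, ih, ← Finset.sum_range_succ (fun i => _ - _)]

end ResidueSum

section JacobiCalculus

variable {𝕜 : Type*} [NontriviallyNormedField 𝕜]

theorem hasDerivAt_eval_jacobiPoly {β γ : 𝕜 → ℕ → 𝕜} {β' γ' : ℕ → 𝕜} {l : 𝕜 → 𝕜} {l' t : 𝕜}
    (hβ : ∀ k, HasDerivAt (fun s => β s k) (β' k) t)
    (hγ : ∀ k, HasDerivAt (fun s => γ s k) (γ' k) t) (hl : HasDerivAt l l' t) (k : ℕ) :
    HasDerivAt (fun s => (jacobiPoly (β s) (γ s) k).eval (l s))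
      ((jacobiVar (β t) (γ t) β' γ' k).eval (l t) +
        (derivative (jacobiPoly (β t) (γ t) k)).eval (l t) * l') t := by
  induction k using Nat.twoStepInduction with
  | zero => simpa [jacobiPoly, jacobiVar] using hasDerivAt_const t (1 : 𝕜)
  | one =>
    simp only [jacobiPoly, jacobiVar, eval_sub, eval_X, eval_C, eval_neg, derivative_sub,
      derivative_X, derivative_C, eval_one, sub_zero, one_mul]
    exact (hl.sub (hβ 0)).congr_deriv (by ring)
  | more k h0 h1 =>
    simp only [jacobiPoly_add_two, jacobiVar_add_two, eval_sub, eval_mul, eval_X, eval_C,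
      derivative_sub, derivative_mul, derivative_X, derivative_C, eval_add, eval_one, sub_zero,
      eval_zero]
    exact (((hl.sub (hβ (k + 1))).mul h1).sub ((hγ k).mul h0)).congr_deriv (by
      simp only [Pi.sub_apply]; ring)

theorem contDiffAt_eval_jacobiPoly {E : Type*} [NormedAddCommGroup E] [NormedSpace 𝕜 E]
    {m : WithTop ℕ∞} {β γ : E → ℕ → 𝕜} {l : E → 𝕜} {z : E}
    (hβ : ∀ k, ContDiffAt 𝕜 m (fun y => β y k) z) (hγ : ∀ k, ContDiffAt 𝕜 m (fun y => γ y k) z)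
    (hl : ContDiffAt 𝕜 m l z) (k : ℕ) :
    ContDiffAt 𝕜 m (fun y => (jacobiPoly (β y) (γ y) k).eval (l y)) z := by
  induction k using Nat.twoStepInduction with
  | zero => simpa only [jacobiPoly, eval_one] using contDiffAt_const
  | one => simpa only [jacobiPoly, eval_sub, eval_X, eval_C] using hl.sub (hβ 0)
  | more k h0 h1 =>
    simpa only [jacobiPoly_add_two, eval_sub, eval_mul, eval_X, eval_C] using
      ((hl.sub (hβ (k + 1))).mul h1).sub ((hγ k).mul h0)

end JacobiCalculus

/-! ### Orthogonal polynomials -/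

section OrthoPoly

variable {K : Type*} [Field K]

/-- The monic orthogonal polynomials of the bilinear form `(p, q) ↦ L (p q)`, defined by their
three-term recurrence. Division by zero makes `orthoPoly L (k + 1)` a junk value where
`L (p_j ^ 2) = 0` for some `j ≤ k`. -/
noncomputable def orthoPoly (L : K[X] →ₗ[K] K) : ℕ → K[X]
  | 0 => 1
  | 1 => X - C (L X / L 1)
  | k + 2 =>
    (X - C (L (X * orthoPoly L (k + 1) * orthoPoly L (k + 1)) /
        L (orthoPoly L (k + 1) * orthoPoly L (k + 1)))) * orthoPoly L (k + 1) -
      C (L (orthoPoly L (k + 1) * orthoPoly L (k + 1)) /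
        L (orthoPoly L k * orthoPoly L k)) * orthoPoly L k

variable (L : K[X] →ₗ[K] K)

/-- The squared norm of the `k`-th orthogonal polynomial. -/
noncomputable def orthoNorm (k : ℕ) : K := L (orthoPoly L k * orthoPoly L k)

/-- The diagonal coefficient of the three-term recurrence. -/
noncomputable def orthoDiag (k : ℕ) : K := L (X * orthoPoly L k * orthoPoly L k) / orthoNorm L k

/-- The squared off-diagonal coefficient of the three-term recurrence. -/
noncomputable def orthoOff (k : ℕ) : K := orthoNorm L (k + 1) / orthoNorm L k

theorem orthoPoly_add_two (k : ℕ) : orthoPoly L (k + 2) =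
    (X - C (orthoDiag L (k + 1))) * orthoPoly L (k + 1) - C (orthoOff L k) * orthoPoly L k := rfl

theorem orthoPoly_one : orthoPoly L 1 = X - C (orthoDiag L 0) := by
  simp [orthoPoly, orthoDiag, orthoNorm]

theorem orthoPoly_eq_jacobiPoly (k : ℕ) :
    orthoPoly L k = jacobiPoly (orthoDiag L) (orthoOff L) k := by
  induction k using Nat.twoStepInduction with
  | zero => rfl
  | one => rw [orthoPoly_one, jacobiPoly]
  | more k h0 h1 => rw [orthoPoly_add_two, h0, h1, jacobiPoly_add_two]

theorem degree_sub_C_mul_orthoPoly_lt {k : ℕ} {q : K[X]} (hq : q.natDegree ≤ k) :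
    (q - C (q.coeff k) * orthoPoly L k).degree < k := by
  rw [orthoPoly_eq_jacobiPoly, degree_lt_iff_coeff_zero]
  intro j hj
  rw [coeff_sub, coeff_C_mul]
  rcases hj.eq_or_lt with rfl | hj
  · rw [coeff_jacobiPoly_self, mul_one, sub_self]
  · rw [coeff_jacobiPoly_of_lt hj, mul_zero, sub_zero]
    exact coeff_eq_zero_of_natDegree_lt (hq.trans_lt hj)

theorem linearMap_C_mul (a : K) (q : K[X]) : L (C a * q) = a * L q := by
  rw [← smul_eq_C_mul, map_smul, smul_eq_mul]

variable {L}

theorem orthoPoly_mul_of_orthogonal {k : ℕ}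
    (hk : ∀ r : K[X], r.degree < k → L (orthoPoly L k * r) = 0) {q : K[X]}
    (hq : q.natDegree ≤ k) : L (orthoPoly L k * q) = orthoNorm L k * q.coeff k := by
  have h := hk _ (degree_sub_C_mul_orthoPoly_lt L hq)
  rw [mul_sub, mul_left_comm, map_sub, linearMap_C_mul, sub_eq_zero] at h
  rw [h, orthoNorm, mul_comm]

theorem orthoPoly_add_two_mul_low {k : ℕ} (h0 : orthoNorm L k ≠ 0)
    (hk : ∀ r : K[X], r.degree < k → L (orthoPoly L k * r) = 0)
    (hk1 : ∀ r : K[X], r.degree < (k + 1 : ℕ) → L (orthoPoly L (k + 1) * r) = 0)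
    {r : K[X]} (hr : r.degree < (k + 1 : ℕ)) : L (orthoPoly L (k + 2) * r) = 0 := by
  have hrk : r.natDegree ≤ k :=
    natDegree_le_iff_coeff_eq_zero.2 ((degree_lt_iff_coeff_zero _ _).1 hr)
  have hX : (X * r).natDegree ≤ k + 1 := by
    rw [add_comm]; exact natDegree_mul_le_of_le natDegree_X_le hrk
  have hrec : orthoPoly L (k + 2) * r = orthoPoly L (k + 1) * (X * r) -
      C (orthoDiag L (k + 1)) * (orthoPoly L (k + 1) * r) -
      C (orthoOff L k) * (orthoPoly L k * r) := by
    rw [orthoPoly_add_two]; ring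
  rw [hrec, map_sub, map_sub, linearMap_C_mul, linearMap_C_mul, orthoPoly_mul_of_orthogonal hk1 hX,
    hk1 r hr, orthoPoly_mul_of_orthogonal hk hrk, coeff_X_mul, orthoOff]
  field_simp
  ring

theorem orthoPoly_add_two_mul_pred {k : ℕ} (h1 : orthoNorm L (k + 1) ≠ 0)
    (hk1 : ∀ r : K[X], r.degree < (k + 1 : ℕ) → L (orthoPoly L (k + 1) * r) = 0) :
    L (orthoPoly L (k + 2) * orthoPoly L (k + 1)) = 0 := by
  have hrec : orthoPoly L (k + 2) * orthoPoly L (k + 1) =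
      X * orthoPoly L (k + 1) * orthoPoly L (k + 1) -
      C (orthoDiag L (k + 1)) * (orthoPoly L (k + 1) * orthoPoly L (k + 1)) -
      C (orthoOff L k) * (orthoPoly L (k + 1) * orthoPoly L k) := by
    rw [orthoPoly_add_two]; ring
  have hdeg : (orthoPoly L k).degree < (k + 1 : ℕ) := by
    rw [orthoPoly_eq_jacobiPoly]
    exact degree_le_natDegree.trans_lt
      (by exact_mod_cast Nat.lt_succ_of_le (natDegree_jacobiPoly_le k))
  rw [hrec, map_sub, map_sub, linearMap_C_mul, linearMap_C_mul, hk1 _ hdeg, ← orthoNorm, orthoDiag,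
    div_mul_cancel₀ _ h1, mul_zero, sub_self, sub_zero]

theorem orthoPoly_orthogonal {k : ℕ} (hN : ∀ j < k, orthoNorm L j ≠ 0) {q : K[X]}
    (hq : q.degree < k) : L (orthoPoly L k * q) = 0 := by
  induction k using Nat.twoStepInduction generalizing q with
  | zero =>
    rw [Nat.cast_zero, Nat.WithBot.lt_zero_iff, degree_eq_bot] at hq
    rw [hq, mul_zero, map_zero]
  | one =>
    have h0 : L 1 ≠ 0 := by simpa [orthoNorm, orthoPoly] using hN 0 one_pos
    have hC : q = C (q.coeff 0) := eq_C_of_natDegree_le_zero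
      (natDegree_le_iff_coeff_eq_zero.2 ((degree_lt_iff_coeff_zero _ _).1 hq))
    rw [hC, mul_comm, linearMap_C_mul, orthoPoly, ← mul_one (C (L X / L 1)), map_sub,
      linearMap_C_mul, div_mul_cancel₀ _ h0, sub_self, mul_zero]
  | more k ih0 ih1 =>
    have hk : ∀ r : K[X], r.degree < k → L (orthoPoly L k * r) = 0 :=
      fun r => ih0 fun j hj => hN j (by omega)
    have hk1 : ∀ r : K[X], r.degree < (k + 1 : ℕ) → L (orthoPoly L (k + 1) * r) = 0 :=
      fun r => ih1 fun j hj => hN j (by omega)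
    have hqk : q.natDegree ≤ k + 1 :=
      natDegree_le_iff_coeff_eq_zero.2 ((degree_lt_iff_coeff_zero _ _).1 hq)
    have hlow := orthoPoly_add_two_mul_low (hN k (by omega)) hk hk1
      (degree_sub_C_mul_orthoPoly_lt L hqk)
    rwa [mul_sub, mul_left_comm, map_sub, linearMap_C_mul,
      orthoPoly_add_two_mul_pred (hN (k + 1) (by omega)) hk1, mul_zero, sub_zero] at hlow

theorem orthoPoly_mul {k : ℕ} (hN : ∀ j < k, orthoNorm L j ≠ 0) {q : K[X]}
    (hq : q.natDegree ≤ k) : L (orthoPoly L k * q) = orthoNorm L k * q.coeff k :=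
  orthoPoly_mul_of_orthogonal (fun _ => orthoPoly_orthogonal hN) hq

end OrthoPoly

section DiscreteFunctional

variable {ι : Type*} [Fintype ι]

/-- Integration of polynomials against the measure with mass `w i` at `μ i`. -/
noncomputable def discreteFunctional {K : Type*} [Field K] (w μ : ι → K) : K[X] →ₗ[K] K :=
  ∑ i, w i • leval (μ i)

section Field

variable {K : Type*} [Field K] {w μ : ι → K}

theorem discreteFunctional_apply (q : K[X]) :
    discreteFunctional w μ q = ∑ i, w i * q.eval (μ i) := by
  simp [discreteFunctional, LinearMap.sum_apply]

theorem discreteFunctional_mul_nodal_erase [DecidableEq ι] (p : K[X]) (i : ι) :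
    discreteFunctional w μ (p * Lagrange.nodal (Finset.univ.erase i) μ) =
      w i * (p.eval (μ i) * ∏ j ∈ Finset.univ.erase i, (μ i - μ j)) := by
  rw [discreteFunctional_apply, Finset.sum_eq_single_of_mem i (Finset.mem_univ i),
    eval_mul, Lagrange.eval_nodal]
  intro j _ hj
  rw [eval_mul, Lagrange.eval_nodal_at_node (Finset.mem_erase.2 ⟨hj, Finset.mem_univ j⟩),
    mul_zero, mul_zero]

theorem eval_orthoPoly_card (hw : ∀ i, w i ≠ 0) (hμ : Function.Injective μ)
    (hN : ∀ k < Fintype.card ι, orthoNorm (discreteFunctional w μ) k ≠ 0) (i : ι) :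
    (orthoPoly (discreteFunctional w μ) (Fintype.card ι)).eval (μ i) = 0 := by
  classical
  have hdeg : (Lagrange.nodal (Finset.univ.erase i) μ).degree < Fintype.card ι := by
    rw [Lagrange.degree_nodal]
    exact_mod_cast Finset.card_erase_lt_of_mem (Finset.mem_univ i)
  have horth := orthoPoly_orthogonal hN hdeg
  rw [discreteFunctional_mul_nodal_erase] at horth
  have hne : ∏ j ∈ Finset.univ.erase i, (μ i - μ j) ≠ 0 :=
    Finset.prod_ne_zero_iff.2 fun j hj => sub_ne_zero.2 (hμ.ne (Finset.ne_of_mem_erase hj).symm)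
  exact ((mul_eq_zero.1 horth).resolve_left (hw i) |> mul_eq_zero.1).resolve_right hne

theorem eval_orthoPoly_card_sub_one [DecidableEq ι]
    (hN : ∀ k < Fintype.card ι - 1, orthoNorm (discreteFunctional w μ) k ≠ 0) (i : ι) :
    w i * ((orthoPoly (discreteFunctional w μ) (Fintype.card ι - 1)).eval (μ i) *
        ∏ j ∈ Finset.univ.erase i, (μ i - μ j)) =
      orthoNorm (discreteFunctional w μ) (Fintype.card ι - 1) := by
  have hdeg : (Lagrange.nodal (Finset.univ.erase i) μ).natDegree = Fintype.card ι - 1 := by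
    rw [Lagrange.natDegree_nodal, Finset.card_erase_of_mem (Finset.mem_univ i), Finset.card_univ]
  have hcoeff := (Lagrange.nodal_monic (s := Finset.univ.erase i) (v := μ)).coeff_natDegree
  rw [hdeg] at hcoeff
  rw [← discreteFunctional_mul_nodal_erase, orthoPoly_mul hN hdeg.le, hcoeff, mul_one]

end Field

section OrderedField

variable {K : Type*} [Field K] [LinearOrder K] [IsStrictOrderedRing K] {w μ : ι → K}

theorem discreteFunctional_mul_self_pos (hw : ∀ i, 0 < w i) (hμ : Function.Injective μ)
    {q : K[X]} (hq : q ≠ 0) (hdeg : q.natDegree < Fintype.card ι) :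
    0 < discreteFunctional w μ (q * q) := by
  rw [discreteFunctional_apply]
  obtain ⟨i, hi⟩ : ∃ i, q.eval (μ i) ≠ 0 := by
    by_contra! h
    exact hq (eq_zero_of_natDegree_lt_card_of_eval_eq_zero q hμ h hdeg)
  refine Finset.sum_pos' (fun j _ => ?_) ⟨i, Finset.mem_univ i, ?_⟩
  · rw [eval_mul]; exact mul_nonneg (hw j).le (mul_self_nonneg _)
  · rw [eval_mul]; exact mul_pos (hw i) (mul_self_pos.2 hi)

theorem orthoNorm_pos (hw : ∀ i, 0 < w i) (hμ : Function.Injective μ) {k : ℕ}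
    (hk : k < Fintype.card ι) : 0 < orthoNorm (discreteFunctional w μ) k := by
  refine discreteFunctional_mul_self_pos hw hμ ?_ ?_ <;> rw [orthoPoly_eq_jacobiPoly]
  exacts [(monic_jacobiPoly k).ne_zero, (natDegree_jacobiPoly_le k).trans_lt hk]

theorem orthoOff_pos (hw : ∀ i, 0 < w i) (hμ : Function.Injective μ) {k : ℕ}
    (hk : k + 1 < Fintype.card ι) : 0 < orthoOff (discreteFunctional w μ) k :=
  div_pos (orthoNorm_pos hw hμ hk) (orthoNorm_pos hw hμ (by omega))

end OrderedField

section Smooth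

variable {𝕜 E : Type*} [NontriviallyNormedField 𝕜] [NormedAddCommGroup E] [NormedSpace 𝕜 E]
  {m : WithTop ℕ∞} {w μ : E → ι → 𝕜} {z : E} {k : ℕ}

theorem contDiffAt_discreteFunctional {q : E → 𝕜[X]} (hw : ∀ i, ContDiffAt 𝕜 m (fun y => w y i) z)
    (hq : ∀ i, ContDiffAt 𝕜 m (fun y => (q y).eval (μ y i)) z) :
    ContDiffAt 𝕜 m (fun y => discreteFunctional (w y) (μ y) (q y)) z := by
  simp only [discreteFunctional_apply]
  exact ContDiffAt.sum fun i _ => (hw i).mul (hq i)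

theorem contDiffAt_orthoNorm (hw : ∀ i, ContDiffAt 𝕜 m (fun y => w y i) z)
    (hp : ∀ i, ContDiffAt 𝕜 m
      (fun y => (orthoPoly (discreteFunctional (w y) (μ y)) k).eval (μ y i)) z) :
    ContDiffAt 𝕜 m (fun y => orthoNorm (discreteFunctional (w y) (μ y)) k) z :=
  contDiffAt_discreteFunctional hw fun i => by
    simpa only [eval_mul] using (hp i).mul (hp i)

theorem contDiffAt_orthoDiag (hw : ∀ i, ContDiffAt 𝕜 m (fun y => w y i) z)
    (hμ : ∀ i, ContDiffAt 𝕜 m (fun y => μ y i) z)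
    (hp : ∀ i, ContDiffAt 𝕜 m
      (fun y => (orthoPoly (discreteFunctional (w y) (μ y)) k).eval (μ y i)) z)
    (hN : orthoNorm (discreteFunctional (w z) (μ z)) k ≠ 0) :
    ContDiffAt 𝕜 m (fun y => orthoDiag (discreteFunctional (w y) (μ y)) k) z := by
  refine (contDiffAt_discreteFunctional hw fun i => ?_).div (contDiffAt_orthoNorm hw hp) hN
  simpa only [eval_mul, eval_X] using ((hμ i).mul (hp i)).mul (hp i)

theorem contDiffAt_eval_orthoPoly (hw : ∀ i, ContDiffAt 𝕜 m (fun y => w y i) z)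
    (hμ : ∀ i, ContDiffAt 𝕜 m (fun y => μ y i) z)
    (hN : ∀ j < k, orthoNorm (discreteFunctional (w z) (μ z)) j ≠ 0) {l : E → 𝕜}
    (hl : ContDiffAt 𝕜 m l z) :
    ContDiffAt 𝕜 m (fun y => (orthoPoly (discreteFunctional (w y) (μ y)) k).eval (l y)) z := by
  have h0 (l' : E → 𝕜) :
      ContDiffAt 𝕜 m (fun y => (orthoPoly (discreteFunctional (w y) (μ y)) 0).eval (l' y)) z := by
    simpa only [orthoPoly, eval_one] using contDiffAt_const
  induction k using Nat.twoStepInduction generalizing l with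
  | zero => exact h0 l
  | one =>
    simpa only [orthoPoly_one, eval_sub, eval_X, eval_C] using
      hl.sub (contDiffAt_orthoDiag hw hμ (fun i => h0 _) (hN 0 one_pos))
  | more k ih0 ih1 =>
    have hk {l : E → 𝕜} := ih0 (l := l) fun j hj => hN j (by omega)
    have hk1 {l : E → 𝕜} := ih1 (l := l) fun j hj => hN j (by omega)
    have hdiag := contDiffAt_orthoDiag hw hμ (fun i => hk1 (hμ i)) (hN (k + 1) (by omega))
    have hoff : ContDiffAt 𝕜 m (fun y => orthoOff (discreteFunctional (w y) (μ y)) k) z :=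
      (contDiffAt_orthoNorm hw fun i => hk1 (hμ i)).div (contDiffAt_orthoNorm hw fun i => hk (hμ i))
        (hN k (by omega))
    simpa only [orthoPoly_add_two, eval_sub, eval_mul, eval_X, eval_C] using
      ((hl.sub hdiag).mul (hk1 hl)).sub (hoff.mul (hk hl))

end Smooth

end DiscreteFunctional

/-! ### Forms on submanifolds -/

section Submanifold

variable {E F : Type*} [NormedAddCommGroup E] [NormedSpace ℝ E]
  [NormedAddCommGroup F] [NormedSpace ℝ F] {φ : E → F} {M U : Set E} {x : E}

theorem smoothOnSubset_of_contDiffOn (hU : IsOpen U) (hMU : M ⊆ U) (hφ : ContDiffOn ℝ ∞ φ U) :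
    SmoothOnSubset φ M :=
  fun _ hx => ⟨U, hU, hMU hx, φ, hφ, Set.eqOn_refl φ _⟩

theorem fderivWithin_eq_fderiv_of_mem_tangentConeAt (hφ : DifferentiableAt ℝ φ x) {u : E}
    (hu : u ∈ tangentConeAt ℝ M x) : fderivWithin ℝ φ M x u = fderiv ℝ φ x u :=
  hφ.differentiableWithinAt.hasFDerivWithinAt.unique_on hφ.hasFDerivAt.hasFDerivWithinAt hu

theorem pullbackForm_formEqAt (hφ : DifferentiableAt ℝ φ x) {k : ℕ}
    (β : F → F [⋀^Fin k]→L[ℝ] ℝ) :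
    FormEqAt M x (pullbackForm φ M β x) ((β (φ x)).compContinuousLinearMap (fderiv ℝ φ x)) := by
  intro v hv
  change β (φ x) (fun i => fderivWithin ℝ φ M x (v i)) = β (φ x) (fun i => fderiv ℝ φ x (v i))
  simp only [fderivWithin_eq_fderiv_of_mem_tangentConeAt hφ (hv _)]

theorem contDiffOn_compContinuousLinearMap_fderiv (hU : IsOpen U) (hφ : ContDiffOn ℝ ∞ φ U)
    {θ : F → F [⋀^Fin 1]→L[ℝ] ℝ} (hθ : ContDiff ℝ ∞ θ) :
    ContDiffOn ℝ ∞ (fun y => (θ (φ y)).compContinuousLinearMap (fderiv ℝ φ y)) U := by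
  let eE : (E →L[ℝ] ℝ) ≃ₗᵢ[ℝ] E [⋀^Fin 1]→L[ℝ] ℝ := ContinuousAlternatingMap.ofSubsingletonLIE 0
  let eF : (F →L[ℝ] ℝ) ≃ₗᵢ[ℝ] F [⋀^Fin 1]→L[ℝ] ℝ := ContinuousAlternatingMap.ofSubsingletonLIE 0
  have hlin : ContDiffOn ℝ ∞ (fun y => eF.symm (θ (φ y))) U :=
    eF.symm.contDiff.comp_contDiffOn (hθ.comp_contDiffOn hφ)
  have hcomp := eE.contDiff.comp_contDiffOn
    (hlin.clm_comp (hφ.fderiv_of_isOpen hU (m := ∞) (by simp)))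
  refine hcomp.congr fun y _ => ?_
  conv_lhs => rw [← eF.apply_symm_apply (θ (φ y))]
  rfl

theorem isPrimitiveOn_pullbackForm (hU : IsOpen U) (hMU : M ⊆ U) (hφ : ContDiffOn ℝ ∞ φ U)
    {θ : F → F [⋀^Fin 1]→L[ℝ] ℝ} (hθ : ContDiff ℝ ∞ θ) :
    IsPrimitiveOn M (pullbackForm φ M θ) (pullbackForm φ M (extDeriv θ)) := by
  have hdiff : ∀ y ∈ M, ContDiffAt ℝ ∞ φ y := fun y hy => hφ.contDiffAt (hU.mem_nhds (hMU hy))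
  refine fun x hx => ⟨U, hU, hMU hx, _, contDiffOn_compContinuousLinearMap_fderiv hU hφ hθ, ?_, ?_⟩
  · exact fun y hy v hv =>
      (pullbackForm_formEqAt ((hdiff y hy.2).differentiableAt (by simp)) θ v hv).symm
  · intro y hy v hv
    have hr : minSmoothness ℝ 2 ≤ (∞ : WithTop ℕ∞) := by
      rw [minSmoothness_of_isRCLikeNormedField]
      exact WithTop.coe_le_coe.2 le_top
    rw [extDeriv_pullback (hθ.differentiable (by simp)).differentiableAt (hdiff y hy.2) hr]
    exact (pullbackForm_formEqAt ((hdiff y hy.2).differentiableAt (by simp)) _ v hv).symm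

theorem IsPrimitiveOn.congr {k : ℕ} {θ : E → E [⋀^Fin k]→L[ℝ] ℝ}
    {η η' : E → E [⋀^Fin (k + 1)]→L[ℝ] ℝ} (h : IsPrimitiveOn M θ η)
    (hη : ∀ x ∈ M, FormEqAt M x (η x) (η' x)) : IsPrimitiveOn M θ η' := by
  intro x hx
  obtain ⟨W, hW, hxW, Θ, hΘ, hθ, hd⟩ := h x hx
  exact ⟨W, hW, hxW, Θ, hΘ, hθ, fun y hy v hv => (hd y hy v hv).trans (hη y hy.2 v hv)⟩

end Submanifold

theorem isOpen_setOf_strictMono {ι α : Type*} [Preorder ι] [Finite ι] [TopologicalSpace α]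
    [LinearOrder α] [OrderClosedTopology α] : IsOpen {μ : ι → α | StrictMono μ} := by
  have hInter : {μ : ι → α | StrictMono μ} = ⋂ i, ⋂ j, ⋂ _ : i < j, {μ | μ i < μ j} := by
    ext μ
    simp only [Set.mem_ofPred_eq, Set.mem_iInter]
    rfl
  rw [hInter]
  exact isOpen_iInter_of_finite fun i => isOpen_iInter_of_finite fun j =>
    isOpen_iInter_of_finite fun _ => isOpen_lt (continuous_apply i) (continuous_apply j)

theorem exists_contDiffAt_implicit {𝕜 E : Type*} [RCLike 𝕜] [NormedAddCommGroup E]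
    [NormedSpace 𝕜 E] [CompleteSpace E] {n : WithTop ℕ∞} (hn : n ≠ 0) {f : E × 𝕜 → 𝕜} {x : E}
    {r d : 𝕜} (hf : ContDiffAt 𝕜 n f (x, r)) (hd : HasDerivAt (fun t => f (x, t)) d r)
    (hd0 : d ≠ 0) :
    ∃ g : E → 𝕜, ContDiffAt 𝕜 n g x ∧ g x = r ∧ ∀ᶠ y in nhds x, f (y, g y) = f (x, r) := by
  have hcurve : HasDerivAt (fun t : 𝕜 => (x, t)) ((0 : E), (1 : 𝕜)) r :=
    (hasDerivAt_const r x).prodMk (hasDerivAt_id r)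
  have hval : fderiv 𝕜 f (x, r) (0, 1) = d :=
    ((hf.differentiableAt hn).hasFDerivAt.comp_hasDerivAt r hcurve).unique hd
  have hinv : (fderiv 𝕜 f (x, r) ∘L .inr 𝕜 E 𝕜).IsInvertible := by
    refine ⟨ContinuousLinearEquiv.unitsEquivAut 𝕜 (Units.mk0 d hd0), ?_⟩
    ext
    simp [hval]
  exact ⟨hf.implicitFunction hn hinv, hf.contDiffAt_implicitFunction hn hinv,
    hf.implicitFunction_apply_self hn hinv, hf.eventually_apply_implicitFunction hn hinv⟩

@[to_additive]
theorem prod_zmod_eq_prod_range {M : Type*} [CommMonoid M] (n : ℕ) [NeZero n] (g : ZMod n → M) :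
    ∏ i, g i = ∏ j ∈ Finset.range n, g ((j + 1 : ℕ) : ZMod n) := by
  rw [← Equiv.prod_comp (Equiv.addRight (1 : ZMod n)) g]
  refine Finset.prod_bij' (fun b _ => b.val) (fun j _ => (j : ZMod n))
    (fun b _ => Finset.mem_range.2 b.val_lt) (fun _ _ => Finset.mem_univ _) ?_ ?_ ?_
  · exact fun b _ => ZMod.natCast_zmod_val b
  · exact fun j hj => ZMod.val_cast_of_lt (Finset.mem_range.1 hj)
  · intro b _
    simp

@[to_additive]
theorem prod_zmod_eq_prod_range_pred_mul {M : Type*} [CommMonoid M] (n : ℕ) [NeZero n]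
    (g : ZMod n → M) :
    ∏ i, g i = (∏ j ∈ Finset.range (n - 1), g ((j + 2 : ℕ) : ZMod n)) * g 1 := by
  obtain ⟨k, rfl⟩ := Nat.exists_eq_add_of_le' (NeZero.one_le (n := n))
  rw [prod_zmod_eq_prod_range, Finset.prod_range_succ', zero_add, Nat.cast_one]
  rfl

theorem sum_Icc_add_sum_range {R : Type*} [CommRing R] (A B : ℕ → R) (m : ℕ) :
    (∑ i ∈ Finset.Icc 2 (m + 1), ∑ j ∈ Finset.Icc 1 (i - 1), B i * A j) +
      ∑ j ∈ Finset.range m, A (j + 2) * ∑ i ∈ Finset.range (j + 1), B (i + 2) =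
    (∑ j ∈ Finset.range m, B (j + 2)) * ∑ j ∈ Finset.range (m + 1), A (j + 1) := by
  induction m with
  | zero => simp
  | succ m ih =>
    have hlast : ∑ j ∈ Finset.Icc 1 (m + 1 + 1 - 1), B (m + 1 + 1) * A j =
        B (m + 2) * ∑ j ∈ Finset.range (m + 1), A (j + 1) := by
      rw [← Finset.mul_sum, Nat.add_sub_cancel, Finset.range_eq_Ico,
        Finset.sum_Ico_add' A 0 (m + 1) 1]
      rfl
    rw [Finset.sum_Icc_succ_top (by omega), hlast, Finset.sum_range_succ _ (m + 1),
      Finset.sum_range_succ (fun j => A (j + 2) * _) m, Finset.sum_range_succ (fun j => B (j + 2))]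
    linear_combination ih

namespace Toda

/-! ### Dirichlet eigenvalues of a periodic Jacobi matrix -/

section Dirichlet

variable {n : ℕ}

/-- The diagonal entries `b_2, b_3, …`. -/
def diag (x : Flaschka n) (k : ℕ) : ℝ := x.1 ((k + 2 : ℕ) : ZMod n)

/-- The squares of the off-diagonal entries `a_2, a_3, …`. -/
def offDiagSq (x : Flaschka n) (k : ℕ) : ℝ := x.2 ((k + 2 : ℕ) : ZMod n) ^ 2

/-- The characteristic polynomial of the Jacobi matrix with diagonal `b_2, …, b_{k+1}`. -/
noncomputable def charPoly (x : Flaschka n) (k : ℕ) : ℝ[X] := jacobiPoly (diag x) (offDiagSq x) k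

/-- The product `a_1 ⋯ a_k`. -/
noncomputable def prodA (x : Flaschka n) (k : ℕ) : ℝ :=
  ∏ j ∈ Finset.range k, x.2 ((j + 1 : ℕ) : ZMod n)

/-- The constant `a_n / (a_1 ⋯ a_{n-1})`: the leading coefficient of `y₁(n, ·)` up to sign. -/
noncomputable def leadingConst (x : Flaschka n) : ℝ := x.2 0 / prodA x (n - 1)

/-- The open set of all `(b, a)` with positive `a`. -/
def positiveRegion (n : ℕ) : Set (Flaschka n) := {x | ∀ i, 0 < x.2 i}

theorem phaseSpace_subset (n : ℕ) [NeZero n] (α : ℝ) : phaseSpace n α ⊆ positiveRegion n :=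
  fun _ hx => hx.1

theorem isOpen_positiveRegion (n : ℕ) [NeZero n] : IsOpen (positiveRegion n) := by
  rw [positiveRegion, Set.ofPred_forall]
  exact isOpen_iInter_of_finite fun i =>
    isOpen_lt continuous_const ((continuous_apply i).comp continuous_snd)

variable {x : Flaschka n}

theorem offDiagSq_pos (hx : x ∈ positiveRegion n) (k : ℕ) : 0 < offDiagSq x k :=
  pow_pos (hx _) 2

theorem prodA_succ (x : Flaschka n) (k : ℕ) :
    prodA x (k + 1) = prodA x k * x.2 ((k + 1 : ℕ) : ZMod n) :=
  Finset.prod_range_succ _ k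

theorem prodA_pos (hx : x ∈ positiveRegion n) (k : ℕ) : 0 < prodA x k :=
  Finset.prod_pos fun _ _ => hx _

theorem leadingConst_pos (hx : x ∈ positiveRegion n) : 0 < leadingConst x :=
  div_pos (hx 0) (prodA_pos hx _)

theorem y₁_add_two (hx : x ∈ positiveRegion n) (k : ℕ) :
    y₁ x (k + 2) = C (-(x.2 0 / prodA x (k + 1))) * charPoly x k := by
  have hA := fun j => (prodA_pos hx j).ne'
  have ha := fun i => (hx i).ne'
  refine Polynomial.funext fun t => ?_
  induction k using Nat.twoStepInduction with
  | zero => simp [y₁, solution, charPoly, jacobiPoly, prodA, div_eq_inv_mul]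
  | one =>
    simp only [y₁, solution, charPoly, jacobiPoly, prodA, Finset.prod_range_succ,
      Finset.prod_range_zero, diag, eval_mul, eval_sub, eval_C, eval_X, one_mul, Nat.cast_zero]
    field_simp [ha]
    ring
  | more k h0 h1 =>
    have hy : (y₁ x (k + 2 + 2)).eval t = (x.2 ((k + 3 : ℕ) : ZMod n))⁻¹ *
        ((t - x.1 ((k + 3 : ℕ) : ZMod n)) * (y₁ x (k + 1 + 2)).eval t
          - x.2 ((k + 2 : ℕ) : ZMod n) * (y₁ x (k + 2)).eval t) := by
      simp only [y₁, solution, eval_mul, eval_sub, eval_C, eval_X]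
    rw [hy, h0, h1]
    simp only [charPoly, jacobiPoly_add_two, diag, offDiagSq, prodA_succ _ (k + 1),
      prodA_succ _ (k + 2), eval_mul, eval_sub, eval_C, eval_X]
    field_simp [ha, hA]
    ring

theorem wronskian_eq (hx : x ∈ positiveRegion n) (t : ℝ) (k : ℕ) :
    x.2 (k : ZMod n) * ((y₁ x k).eval t * (y₂ x (k + 1)).eval t -
      (y₁ x (k + 1)).eval t * (y₂ x k).eval t) = x.2 0 := by
  induction k with
  | zero => simp [y₁, y₂, solution]
  | succ k ih =>
    have ha := (hx ((k + 1 : ℕ) : ZMod n)).ne'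
    rw [← ih]
    simp only [y₁, y₂, solution, eval_mul, eval_sub, eval_C, eval_X]
    field_simp
    ring

theorem y₁_self (hx : x ∈ positiveRegion n) (hn : 2 ≤ n) :
    y₁ x n = C (-leadingConst x) * charPoly x (n - 2) := by
  obtain ⟨k, rfl⟩ := Nat.exists_eq_add_of_le' hn
  exact y₁_add_two hx k

theorem leadingCoeff_y₁_succ_ne_zero (hx : x ∈ positiveRegion n) : -(x.2 0 / prodA x n) ≠ 0 :=
  neg_ne_zero.2 (div_pos (hx 0) (prodA_pos hx n)).ne'

variable [NeZero n]

theorem y₁_succ (hx : x ∈ positiveRegion n) :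
    y₁ x (n + 1) = C (-(x.2 0 / prodA x n)) * charPoly x (n - 1) := by
  obtain ⟨k, rfl⟩ := Nat.exists_eq_add_of_le' (NeZero.one_le (n := n))
  exact y₁_add_two hx k

theorem natDegree_y₁_succ (hx : x ∈ positiveRegion n) : (y₁ x (n + 1)).natDegree = n - 1 := by
  rw [y₁_succ hx, natDegree_C_mul (leadingCoeff_y₁_succ_ne_zero hx), charPoly, natDegree_jacobiPoly]

theorem roots_y₁_succ_eq_jacobiRoots (hx : x ∈ positiveRegion n) :
    (y₁ x (n + 1)).roots = (jacobiRoots (diag x) (offDiagSq x) (n - 1)).val := by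
  rw [y₁_succ hx, roots_C_mul _ (leadingCoeff_y₁_succ_ne_zero hx), jacobiRoots,
    Multiset.toFinset_val, (nodup_roots_jacobiPoly (offDiagSq_pos hx) _).dedup, charPoly]

theorem dirichlet_eq_orderEmbOfFin (hx : x ∈ positiveRegion n) :
    dirichlet x = (jacobiRoots (diag x) (offDiagSq x) (n - 1)).orderEmbOfFin
      (card_jacobiRoots (offDiagSq_pos hx) (n - 1)) := by
  funext i
  rw [dirichlet, Finset.orderEmbOfFin_apply, List.getD_eq_getElem]
  · simp only [roots_y₁_succ_eq_jacobiRoots hx]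
    rfl
  · rw [roots_y₁_succ_eq_jacobiRoots hx, Multiset.length_sort, Finset.card_val,
      card_jacobiRoots (offDiagSq_pos hx)]
    exact i.2

theorem dirichlet_strictMono (hx : x ∈ positiveRegion n) : StrictMono (dirichlet x) := by
  rw [dirichlet_eq_orderEmbOfFin hx]
  exact OrderEmbedding.strictMono _

theorem image_dirichlet (hx : x ∈ positiveRegion n) :
    Finset.univ.image (dirichlet x) = jacobiRoots (diag x) (offDiagSq x) (n - 1) := by
  rw [dirichlet_eq_orderEmbOfFin hx, Finset.image_orderEmbOfFin_univ]

theorem roots_y₁_succ (hx : x ∈ positiveRegion n) :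
    (y₁ x (n + 1)).roots = Finset.univ.val.map (dirichlet x) := by
  rw [roots_y₁_succ_eq_jacobiRoots hx, ← image_dirichlet hx,
    Finset.image_val_of_injOn (dirichlet_strictMono hx).injective.injOn]

theorem eval_charPoly_dirichlet (hx : x ∈ positiveRegion n) (i : Fin (n - 1)) :
    (charPoly x (n - 1)).eval (dirichlet x i) = 0 := by
  rw [charPoly, ← mem_jacobiRoots, ← image_dirichlet hx]
  exact Finset.mem_image_of_mem _ (Finset.mem_univ i)

theorem dirichlet_eq_of_eval_eq_zero (hx : x ∈ positiveRegion n) {μ : Fin (n - 1) → ℝ}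
    (hμ : StrictMono μ) (h0 : ∀ i, (charPoly x (n - 1)).eval (μ i) = 0) : dirichlet x = μ := by
  rw [dirichlet_eq_orderEmbOfFin hx]
  exact (Finset.orderEmbOfFin_unique _ (fun i => mem_jacobiRoots.2 (h0 i)) hμ).symm

theorem charPoly_eq_prod (hx : x ∈ positiveRegion n) :
    charPoly x (n - 1) = ∏ i, (X - C (dirichlet x i)) := by
  rw [charPoly, ← nodal_jacobiRoots (offDiagSq_pos hx), ← image_dirichlet hx, Lagrange.nodal,
    Finset.prod_image (dirichlet_strictMono hx).injective.injOn]
  rfl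

theorem derivative_charPoly_mul_pos (hx : x ∈ positiveRegion n) (i : Fin (n - 1)) :
    0 < (derivative (charPoly x (n - 1))).eval (dirichlet x i) *
      (charPoly x (n - 2)).eval (dirichlet x i) := by
  have h0 := eval_charPoly_dirichlet hx i
  rw [show n - 1 = n - 2 + 1 by have := i.2; omega] at h0 ⊢
  exact jacobiPoly_derivative_mul_pos (offDiagSq_pos hx) h0

theorem eval_y₁_mul_y₂ (hx : x ∈ positiveRegion n) (i : Fin (n - 1)) :
    (y₁ x n).eval (dirichlet x i) * (y₂ x (n + 1)).eval (dirichlet x i) = 1 := by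
  have h := wronskian_eq hx (dirichlet x i) n
  rw [y₁_succ hx, eval_mul, eval_charPoly_dirichlet hx, mul_zero, zero_mul, sub_zero,
    ZMod.natCast_self] at h
  exact mul_left_cancel₀ (hx 0).ne' (h.trans (mul_one _).symm)

theorem eval_y₂_dirichlet_ne_zero (hx : x ∈ positiveRegion n) (i : Fin (n - 1)) :
    (y₂ x (n + 1)).eval (dirichlet x i) ≠ 0 :=
  right_ne_zero_of_mul_eq_one (eval_y₁_mul_y₂ hx i)

theorem floquetMap_fst (hx : x ∈ positiveRegion n) (i : Fin (n - 1)) :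
    (floquetMap x).1 i =
      -(Real.log (leadingConst x) + Real.log ((charPoly x (n - 2)).eval (dirichlet x i))) := by
  have hy := eval_y₁_mul_y₂ hx i
  have hQ := right_ne_zero_of_mul (derivative_charPoly_mul_pos hx i).ne'
  rw [y₁_self hx (by have := i.2; omega), eval_mul, eval_C] at hy
  simp only [floquetMap]
  rw [eq_inv_of_mul_eq_one_right hy, Real.log_abs, Real.log_inv, neg_mul, Real.log_neg_eq_log,
    Real.log_mul (leadingConst_pos hx).ne' hQ]

/-- The absolute value in `f_i` loses no information: at `μ_i` the sign of `charPoly x (n - 2)` is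
that of the derivative of `charPoly x (n - 1)`, which depends on the Dirichlet eigenvalues only. -/
theorem leadingConst_mul_eval_charPoly (hx : x ∈ positiveRegion n) (i : Fin (n - 1)) :
    leadingConst x * (charPoly x (n - 2)).eval (dirichlet x i) =
      SignType.sign ((derivative (charPoly x (n - 1))).eval (dirichlet x i)) *
        Real.exp (-(floquetMap x).1 i) := by
  have hpos := derivative_charPoly_mul_pos hx i
  have hQ := right_ne_zero_of_mul hpos.ne'
  rw [floquetMap_fst hx, neg_neg, Real.exp_add, Real.exp_log (leadingConst_pos hx),
    Real.exp_log_eq_abs hQ]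
  rcases pos_and_pos_or_neg_and_neg_of_mul_pos hpos with ⟨hP, hQ⟩ | ⟨hP, hQ⟩
  · rw [sign_pos hP, abs_of_pos hQ, SignType.coe_one, one_mul]
  · rw [sign_neg hP, abs_of_neg hQ, SignType.coe_neg_one]
    ring

end Dirichlet

/-! ### The Floquet data determine the matrix -/

section Injectivity

variable {n : ℕ} [NeZero n] {α : ℝ} {x x' : Flaschka n}

theorem leadingConst_mul_pow (hx : x ∈ phaseSpace n α) : leadingConst x * α ^ n = x.2 0 ^ 2 := by
  have hprod : α ^ n = prodA x (n - 1) * x.2 0 := by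
    rw [← hx.2.2, prod_zmod_eq_prod_range]
    obtain ⟨k, rfl⟩ := Nat.exists_eq_add_of_le' (NeZero.one_le (n := n))
    rw [← ZMod.natCast_self (k + 1)]
    exact prodA_succ x k
  have := (prodA_pos (phaseSpace_subset n α hx) (n - 1)).ne'
  rw [hprod, leadingConst]
  field_simp

theorem phaseSpace_ext (hx : x ∈ phaseSpace n α) (hx' : x' ∈ phaseSpace n α)
    (hb : ∀ k < n - 1, x.1 ((k + 2 : ℕ) : ZMod n) = x'.1 ((k + 2 : ℕ) : ZMod n))
    (ha : ∀ k < n - 1, x.2 ((k + 2 : ℕ) : ZMod n) = x'.2 ((k + 2 : ℕ) : ZMod n)) : x = x' := by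
  have hb₁ : x.1 1 = x'.1 1 := by
    have hs := hx.2.1.trans hx'.2.1.symm
    rwa [sum_zmod_eq_sum_range_pred_add, sum_zmod_eq_sum_range_pred_add,
      Finset.sum_congr rfl fun k hk => hb k (Finset.mem_range.1 hk), add_right_inj] at hs
  have ha₁ : x.2 1 = x'.2 1 := by
    have hp := hx.2.2.trans hx'.2.2.symm
    rw [prod_zmod_eq_prod_range_pred_mul, prod_zmod_eq_prod_range_pred_mul,
      Finset.prod_congr rfl fun k hk => ha k (Finset.mem_range.1 hk)] at hp
    exact mul_left_cancel₀ (Finset.prod_pos fun k _ => hx'.1 ((k + 2 : ℕ) : ZMod n)).ne' hp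
  have hcases (i : ZMod n) : i = 1 ∨ ∃ k < n - 1, i = ((k + 2 : ℕ) : ZMod n) := by
    have hi : i = (((i - 1).val + 1 : ℕ) : ZMod n) := by simp
    have hlt := ZMod.val_lt (i - 1)
    rcases h : (i - 1).val with _ | k
    · exact Or.inl (by simpa [h] using hi)
    · exact Or.inr ⟨k, by omega, by rwa [h] at hi⟩
  refine Prod.ext (funext fun i => ?_) (funext fun i => ?_) <;>
    rcases hcases i with rfl | ⟨k, hk, rfl⟩
  exacts [hb₁, hb k hk, ha₁, ha k hk]

theorem charPoly_pred_eq_of_floquetMap_eq (hx : x ∈ positiveRegion n) (hx' : x' ∈ positiveRegion n)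
    (h : floquetMap x = floquetMap x') : charPoly x (n - 1) = charPoly x' (n - 1) := by
  rw [charPoly_eq_prod hx, charPoly_eq_prod hx', show dirichlet x = _ from congrArg Prod.snd h]
  rfl

theorem leadingConst_smul_charPoly_eq_of_floquetMap_eq (hn : 2 ≤ n) (hx : x ∈ positiveRegion n)
    (hx' : x' ∈ positiveRegion n) (h : floquetMap x = floquetMap x') :
    C (leadingConst x) * charPoly x (n - 2) = C (leadingConst x') * charPoly x' (n - 2) := by
  rw [← sub_eq_zero]
  refine eq_zero_of_natDegree_lt_card_of_eval_eq_zero _ (dirichlet_strictMono hx).injective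
    (fun i => ?_) ?_
  · have hμ : dirichlet x = dirichlet x' := congrArg Prod.snd h
    have hP := charPoly_pred_eq_of_floquetMap_eq hx hx' h
    rw [eval_sub, eval_C_mul, eval_C_mul, leadingConst_mul_eval_charPoly hx, hP, h, hμ,
      leadingConst_mul_eval_charPoly hx', sub_self]
  · have hdeg (y : Flaschka n) : (C (leadingConst y) * charPoly y (n - 2)).natDegree ≤ n - 2 :=
      (natDegree_C_mul_le _ _).trans (natDegree_jacobiPoly_le _)
    rw [Fintype.card_fin]
    exact ((natDegree_sub_le _ _).trans (max_le (hdeg x) (hdeg x'))).trans_lt (by omega)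

theorem leadingConst_eq_of_floquetMap_eq (hn : 2 ≤ n) (hx : x ∈ positiveRegion n)
    (hx' : x' ∈ positiveRegion n) (h : floquetMap x = floquetMap x') :
    leadingConst x = leadingConst x' := by
  have hcoeff (y : Flaschka n) :
      (C (leadingConst y) * charPoly y (n - 2)).coeff (n - 2) = leadingConst y := by
    rw [coeff_C_mul, charPoly, coeff_jacobiPoly_self, mul_one]
  rw [← hcoeff x, leadingConst_smul_charPoly_eq_of_floquetMap_eq hn hx hx' h, hcoeff]

theorem floquetMap_injOn : Set.InjOn floquetMap (phaseSpace n α) := by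
  intro x hx x' hx' h
  have hp := phaseSpace_subset n α hx
  have hp' := phaseSpace_subset n α hx'
  obtain hn | hn := Nat.lt_or_ge n 2
  · exact phaseSpace_ext hx hx' (fun k hk => by omega) (fun k hk => by omega)
  have hc := leadingConst_eq_of_floquetMap_eq hn hp hp' h
  have hP := charPoly_pred_eq_of_floquetMap_eq hp hp' h
  have hQ := leadingConst_smul_charPoly_eq_of_floquetMap_eq hn hp hp' h
  rw [hc] at hQ
  have hQ := mul_left_cancel₀ (C_ne_zero.2 (leadingConst_pos hp').ne') hQ
  rw [show n - 1 = n - 2 + 1 by omega] at hP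
  obtain ⟨hb, ha⟩ := jacobiPoly_unique (fun k => (offDiagSq_pos hp k).ne') hQ hP
  have eq_of_sq {i : ZMod n} (hi : x.2 i ^ 2 = x'.2 i ^ 2) : x.2 i = x'.2 i :=
    (pow_left_inj₀ (hp i).le (hp' i).le two_ne_zero).1 hi
  refine phaseSpace_ext hx hx' (fun k hk => hb k (by omega)) fun k hk => eq_of_sq ?_
  obtain hlt | rfl : k < n - 2 ∨ k = n - 2 := by omega
  · exact ha k hlt
  · rw [Nat.sub_add_cancel hn, ZMod.natCast_self, ← leadingConst_mul_pow hx, hc,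
      leadingConst_mul_pow hx']

end Injectivity

/-! ### Reconstruction from the spectral data -/

section Inverse

variable {n : ℕ}

/-- The pairs `(f, μ)` with `μ_1 < ⋯ < μ_{n-1}`. -/
def orderedRegion (n : ℕ) : Set (Target n) := {z | StrictMono z.2}

/-- The weights `e^{f_i} / |∏_{j ≠ i} (μ_i - μ_j)|` of the spectral measure attached to `(f, μ)`. -/
noncomputable def spectralWeight (z : Target n) (i : Fin (n - 1)) : ℝ :=
  Real.exp (z.1 i) / |∏ j ∈ Finset.univ.erase i, (z.2 i - z.2 j)|

/-- Integration against the spectral measure attached to `(f, μ)`. -/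
noncomputable def spectralFunctional (z : Target n) : ℝ[X] →ₗ[ℝ] ℝ :=
  discreteFunctional (spectralWeight z) z.2

/-- The entries `a_2, …, a_n` recovered from `(f, μ)`. The last one is not an entry of the Jacobi
matrix of the spectral measure; its square is `α^n` times `leadingConst`. -/
noncomputable def inverseOffDiag (n : ℕ) (α : ℝ) (z : Target n) (k : ℕ) : ℝ :=
  if k + 1 = n - 1 then √(α ^ n / orthoNorm (spectralFunctional z) k)
  else √(orthoOff (spectralFunctional z) k)

/-- The entries `b_1, …, b_n` recovered from `(f, μ)`, with `b_1` given by `∑ b_i = 0`. -/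
noncomputable def inverseB (z : Target n) : ℕ → ℝ
  | 0 => -∑ k ∈ Finset.range (n - 1), orthoDiag (spectralFunctional z) k
  | k + 1 => orthoDiag (spectralFunctional z) k

/-- The entries `a_1, …, a_n` recovered from `(f, μ)`, with `a_1` given by `∏ a_i = α^n`. -/
noncomputable def inverseA (α : ℝ) (z : Target n) : ℕ → ℝ
  | 0 => α ^ n / ∏ k ∈ Finset.range (n - 1), inverseOffDiag n α z k
  | k + 1 => inverseOffDiag n α z k

/-- The inverse of `floquetMap`, by reconstructing a Jacobi matrix from its spectral measure. -/
noncomputable def inverseMap (n : ℕ) (α : ℝ) (z : Target n) : Flaschka n :=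
  (fun i => inverseB z (i - 1).val, fun i => inverseA α z (i - 1).val)

variable {α : ℝ} {z : Target n}

theorem prod_sub_ne_zero (hz : z ∈ orderedRegion n) (i : Fin (n - 1)) :
    ∏ j ∈ Finset.univ.erase i, (z.2 i - z.2 j) ≠ 0 :=
  Finset.prod_ne_zero_iff.2 fun _ hj =>
    sub_ne_zero.2 fun e => (Finset.mem_erase.1 hj).1 (StrictMono.injective hz e).symm

theorem spectralWeight_pos (hz : z ∈ orderedRegion n) (i : Fin (n - 1)) : 0 < spectralWeight z i :=
  div_pos (Real.exp_pos _) (abs_pos.2 (prod_sub_ne_zero hz i))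

theorem orthoNorm_spectralFunctional_pos (hz : z ∈ orderedRegion n) {k : ℕ} (hk : k < n - 1) :
    0 < orthoNorm (spectralFunctional z) k :=
  orthoNorm_pos (spectralWeight_pos hz) (StrictMono.injective hz) (by rwa [Fintype.card_fin])

theorem orthoOff_spectralFunctional_pos (hz : z ∈ orderedRegion n) {k : ℕ} (hk : k + 1 < n - 1) :
    0 < orthoOff (spectralFunctional z) k :=
  orthoOff_pos (spectralWeight_pos hz) (StrictMono.injective hz) (by rwa [Fintype.card_fin])

theorem eval_orthoPoly_spectralFunctional (hz : z ∈ orderedRegion n) (i : Fin (n - 1)) :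
    (orthoPoly (spectralFunctional z) (n - 1)).eval (z.2 i) = 0 := by
  have h := eval_orthoPoly_card (fun i => (spectralWeight_pos hz i).ne') (StrictMono.injective hz)
    (fun k hk => (orthoNorm_spectralFunctional_pos hz (by rwa [Fintype.card_fin] at hk)).ne') i
  rwa [Fintype.card_fin] at h

theorem abs_eval_orthoPoly_spectralFunctional (hz : z ∈ orderedRegion n) (i : Fin (n - 1)) :
    |(orthoPoly (spectralFunctional z) (n - 2)).eval (z.2 i)| =
      orthoNorm (spectralFunctional z) (n - 2) * Real.exp (-z.1 i) := by
  have hpos := orthoNorm_spectralFunctional_pos hz (k := n - 2) (by have := i.2; omega)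
  have h := eval_orthoPoly_card_sub_one (w := spectralWeight z) (μ := z.2) (fun k hk =>
    (orthoNorm_spectralFunctional_pos hz (by rw [Fintype.card_fin] at hk; omega)).ne') i
  rw [Fintype.card_fin, show n - 1 - 1 = n - 2 by omega, ← spectralFunctional] at h
  have habs := congrArg abs h
  have hprod := abs_ne_zero.2 (prod_sub_ne_zero hz i)
  rw [abs_mul, abs_mul, abs_of_pos (spectralWeight_pos hz i), abs_of_pos hpos,
    spectralWeight] at habs
  rw [← habs, Real.exp_neg]
  field_simp

theorem inverseOffDiag_pos (hα : 0 < α) (hz : z ∈ orderedRegion n) {k : ℕ} (hk : k < n - 1) :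
    0 < inverseOffDiag n α z k := by
  rw [inverseOffDiag]
  split_ifs with hlast
  · exact Real.sqrt_pos.2 (div_pos (pow_pos hα n) (orthoNorm_spectralFunctional_pos hz hk))
  · exact Real.sqrt_pos.2 (orthoOff_spectralFunctional_pos hz (by omega))

theorem prod_inverseOffDiag_pos (hα : 0 < α) (hz : z ∈ orderedRegion n) :
    0 < ∏ k ∈ Finset.range (n - 1), inverseOffDiag n α z k :=
  Finset.prod_pos fun _ hk => inverseOffDiag_pos hα hz (Finset.mem_range.1 hk)

theorem inverseA_pos (hα : 0 < α) (hz : z ∈ orderedRegion n) {k : ℕ} (hk : k < n) :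
    0 < inverseA α z k := by
  rcases k with _ | k
  · exact div_pos (pow_pos hα n) (prod_inverseOffDiag_pos hα hz)
  · exact inverseOffDiag_pos hα hz (by omega)

theorem val_natCast_add_two_sub_one {k : ℕ} (hk : k < n - 1) :
    (((k + 2 : ℕ) : ZMod n) - 1).val = k + 1 := by
  rw [show k + 2 = k + 1 + 1 from rfl, Nat.cast_add, Nat.cast_one, add_sub_cancel_right,
    ZMod.val_cast_of_lt (by omega)]

theorem inverseMap_fst {k : ℕ} (hk : k < n - 1) :
    (inverseMap n α z).1 ((k + 2 : ℕ) : ZMod n) = orthoDiag (spectralFunctional z) k := by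
  simp only [inverseMap, val_natCast_add_two_sub_one hk, inverseB]

theorem inverseMap_snd {k : ℕ} (hk : k < n - 1) :
    (inverseMap n α z).2 ((k + 2 : ℕ) : ZMod n) = inverseOffDiag n α z k := by
  simp only [inverseMap, val_natCast_add_two_sub_one hk, inverseA]

theorem charPoly_inverseMap (hz : z ∈ orderedRegion n) {k : ℕ} (hk : k ≤ n - 1) :
    charPoly (inverseMap n α z) k = orthoPoly (spectralFunctional z) k := by
  rw [orthoPoly_eq_jacobiPoly, charPoly]
  refine jacobiPoly_congr (fun j hj => inverseMap_fst (by omega)) (fun j hj => ?_)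
  rw [offDiagSq, inverseMap_snd (by omega), inverseOffDiag, if_neg (by omega),
    Real.sq_sqrt (orthoOff_spectralFunctional_pos hz (by omega)).le]

variable [NeZero n]

theorem inverseMap_mem (hα : 0 < α) (hz : z ∈ orderedRegion n) :
    inverseMap n α z ∈ phaseSpace n α := by
  refine ⟨fun i => inverseA_pos hα hz (ZMod.val_lt _), ?_, ?_⟩
  · rw [sum_zmod_eq_sum_range_pred_add,
      Finset.sum_congr rfl fun j hj => inverseMap_fst (Finset.mem_range.1 hj)]
    simp [inverseMap, inverseB]
  · rw [prod_zmod_eq_prod_range_pred_mul,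
      Finset.prod_congr rfl fun j hj => inverseMap_snd (Finset.mem_range.1 hj)]
    simpa [inverseMap, inverseA] using mul_div_cancel₀ _ (prod_inverseOffDiag_pos hα hz).ne'

theorem leadingConst_inverseMap (hα : 0 < α) (hz : z ∈ orderedRegion n) (hn : 2 ≤ n) :
    leadingConst (inverseMap n α z) = (orthoNorm (spectralFunctional z) (n - 2))⁻¹ := by
  have hpos := orthoNorm_spectralFunctional_pos hz (k := n - 2) (by omega)
  have hsq : (inverseMap n α z).2 0 ^ 2 = α ^ n / orthoNorm (spectralFunctional z) (n - 2) := by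
    have hlast : (0 : ZMod n) = ((n - 2 + 2 : ℕ) : ZMod n) := by
      rw [Nat.sub_add_cancel hn, ZMod.natCast_self]
    rw [hlast, inverseMap_snd (by omega), inverseOffDiag, if_pos (by omega),
      Real.sq_sqrt (div_pos (pow_pos hα n) hpos).le]
  rw [← leadingConst_mul_pow (inverseMap_mem hα hz)] at hsq
  refine mul_right_cancel₀ (pow_pos hα n).ne' ?_
  rw [hsq, div_eq_inv_mul]

theorem floquetMap_inverseMap (hα : 0 < α) (hz : z ∈ orderedRegion n) :
    floquetMap (inverseMap n α z) = z := by
  have hp := phaseSpace_subset n α (inverseMap_mem hα hz)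
  have hμ : dirichlet (inverseMap n α z) = z.2 := by
    refine dirichlet_eq_of_eval_eq_zero hp hz fun i => ?_
    rw [charPoly_inverseMap hz le_rfl, eval_orthoPoly_spectralFunctional hz]
  refine Prod.ext (funext fun i => ?_) hμ
  have hn : 2 ≤ n := by have := i.2; omega
  have hpos := orthoNorm_spectralFunctional_pos hz (k := n - 2) (by omega)
  rw [floquetMap_fst hp, hμ, charPoly_inverseMap hz (by omega), ← Real.log_abs (eval _ _),
    abs_eval_orthoPoly_spectralFunctional hz, leadingConst_inverseMap hα hz hn, Real.log_inv,
    Real.log_mul hpos.ne' (Real.exp_pos _).ne', Real.log_exp]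
  ring

theorem floquetMap_image (hα : 0 < α) : floquetMap '' phaseSpace n α = orderedRegion n := by
  ext z
  constructor
  · rintro ⟨x, hx, rfl⟩
    exact dirichlet_strictMono (phaseSpace_subset n α hx)
  · exact fun hz => ⟨inverseMap n α z, inverseMap_mem hα hz, floquetMap_inverseMap hα hz⟩

theorem inverseMap_invOn (hα : 0 < α) :
    Set.InvOn (inverseMap n α) floquetMap (phaseSpace n α) (orderedRegion n) := by
  refine ⟨fun x hx => ?_, fun z => floquetMap_inverseMap hα⟩
  have hs := dirichlet_strictMono (phaseSpace_subset n α hx)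
  exact floquetMap_injOn (inverseMap_mem hα hs) hx (floquetMap_inverseMap hα hs)

end Inverse

/-! ### Smoothness -/

section SmoothInverse

variable {n : ℕ} {z : Target n}

theorem isOpen_orderedRegion (n : ℕ) : IsOpen (orderedRegion n) :=
  isOpen_setOf_strictMono.preimage continuous_snd

theorem contDiffAt_target_fst (i : Fin (n - 1)) :
    ContDiffAt ℝ ∞ (fun z : Target n => z.1 i) z :=
  ((contDiff_apply ℝ ℝ i).comp contDiff_fst).contDiffAt

theorem contDiffAt_target_snd (i : Fin (n - 1)) :
    ContDiffAt ℝ ∞ (fun z : Target n => z.2 i) z :=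
  ((contDiff_apply ℝ ℝ i).comp contDiff_snd).contDiffAt

theorem contDiffAt_spectralWeight (hz : z ∈ orderedRegion n) (i : Fin (n - 1)) :
    ContDiffAt ℝ ∞ (fun z => spectralWeight z i) z :=
  (contDiffAt_target_fst i).exp.div
    ((contDiffAt_prod fun j _ => (contDiffAt_target_snd i).sub (contDiffAt_target_snd j)).abs
      (prod_sub_ne_zero hz i))
    (abs_ne_zero.2 (prod_sub_ne_zero hz i))

theorem contDiffAt_eval_orthoPoly_spectralFunctional (hz : z ∈ orderedRegion n) {k : ℕ}
    (hk : k ≤ n - 1) (i : Fin (n - 1)) :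
    ContDiffAt ℝ ∞ (fun z => (orthoPoly (spectralFunctional z) k).eval (z.2 i)) z :=
  contDiffAt_eval_orthoPoly (contDiffAt_spectralWeight hz) contDiffAt_target_snd
    (fun _ hj => (orthoNorm_spectralFunctional_pos hz (hj.trans_le hk)).ne')
    (contDiffAt_target_snd i)

theorem contDiffAt_orthoNorm_spectralFunctional (hz : z ∈ orderedRegion n) {k : ℕ}
    (hk : k ≤ n - 1) : ContDiffAt ℝ ∞ (fun z => orthoNorm (spectralFunctional z) k) z :=
  contDiffAt_orthoNorm (contDiffAt_spectralWeight hz)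
    (contDiffAt_eval_orthoPoly_spectralFunctional hz hk)

theorem contDiffAt_orthoDiag_spectralFunctional (hz : z ∈ orderedRegion n) {k : ℕ}
    (hk : k < n - 1) : ContDiffAt ℝ ∞ (fun z => orthoDiag (spectralFunctional z) k) z :=
  contDiffAt_orthoDiag (contDiffAt_spectralWeight hz) contDiffAt_target_snd
    (contDiffAt_eval_orthoPoly_spectralFunctional hz hk.le)
    (orthoNorm_spectralFunctional_pos hz hk).ne'

theorem contDiffAt_inverseOffDiag {α : ℝ} (hα : 0 < α) (hz : z ∈ orderedRegion n) {k : ℕ}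
    (hk : k < n - 1) : ContDiffAt ℝ ∞ (fun z => inverseOffDiag n α z k) z := by
  have hnorm := contDiffAt_orthoNorm_spectralFunctional hz hk.le
  have hpos := orthoNorm_spectralFunctional_pos hz hk
  unfold inverseOffDiag
  split_ifs with hlast
  · exact (contDiffAt_const.div hnorm hpos.ne').sqrt (div_pos (pow_pos hα n) hpos).ne'
  · exact ((contDiffAt_orthoNorm_spectralFunctional hz (by omega)).div hnorm hpos.ne').sqrt
      (orthoOff_spectralFunctional_pos hz (by omega)).ne'

theorem contDiffAt_inverseMap [NeZero n] {α : ℝ} (hα : 0 < α) (hz : z ∈ orderedRegion n) :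
    ContDiffAt ℝ ∞ (inverseMap n α) z := by
  refine ContDiffAt.prodMk (contDiffAt_pi.2 fun i => ?_) (contDiffAt_pi.2 fun i => ?_) <;>
    have hlt := ZMod.val_lt (i - 1) <;> rcases hi : (i - 1).val with _ | k
  · exact (ContDiffAt.sum fun k hk =>
      contDiffAt_orthoDiag_spectralFunctional hz (Finset.mem_range.1 hk)).neg
  · exact contDiffAt_orthoDiag_spectralFunctional hz (by omega)
  · exact contDiffAt_const.div
      (contDiffAt_prod fun k hk => contDiffAt_inverseOffDiag hα hz (Finset.mem_range.1 hk))
      (prod_inverseOffDiag_pos hα hz).ne'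
  · exact contDiffAt_inverseOffDiag hα hz (by omega)

end SmoothInverse

section Smooth

variable {n : ℕ} [NeZero n] {x : Flaschka n}

theorem contDiff_flaschka_fst (i : ZMod n) : ContDiff ℝ ∞ (fun x : Flaschka n => x.1 i) :=
  (contDiff_apply ℝ ℝ i).comp contDiff_fst

theorem contDiff_flaschka_snd (i : ZMod n) : ContDiff ℝ ∞ (fun x : Flaschka n => x.2 i) :=
  (contDiff_apply ℝ ℝ i).comp contDiff_snd

theorem contDiffAt_eval_charPoly {E : Type*} [NormedAddCommGroup E] [NormedSpace ℝ E]
    {g : E → Flaschka n} {l : E → ℝ} {y : E} (hg : ContDiffAt ℝ ∞ g y) (hl : ContDiffAt ℝ ∞ l y)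
    (k : ℕ) : ContDiffAt ℝ ∞ (fun y => (charPoly (g y) k).eval (l y)) y :=
  contDiffAt_eval_jacobiPoly (fun _ => (contDiff_flaschka_fst _).contDiffAt.comp y hg)
    (fun _ => ((contDiff_flaschka_snd _).contDiffAt.comp y hg).pow 2) hl k

theorem contDiffAt_leadingConst (hx : x ∈ positiveRegion n) : ContDiffAt ℝ ∞ leadingConst x :=
  (contDiff_flaschka_snd 0).contDiffAt.div
    (contDiffAt_prod fun _ _ => (contDiff_flaschka_snd _).contDiffAt) (prodA_pos hx _).ne'

theorem contDiffAt_dirichlet (hx : x ∈ positiveRegion n) : ContDiffAt ℝ ∞ dirichlet x := by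
  have hroot (i : Fin (n - 1)) : ∃ g : Flaschka n → ℝ, ContDiffAt ℝ ∞ g x ∧ g x = dirichlet x i ∧
      ∀ᶠ y in nhds x, (charPoly y (n - 1)).eval (g y) = 0 := by
    simpa only [eval_charPoly_dirichlet hx] using
      exists_contDiffAt_implicit (f := fun u => (charPoly u.1 (n - 1)).eval u.2) (by simp)
        (contDiffAt_eval_charPoly contDiffAt_fst contDiffAt_snd (n - 1))
        ((charPoly x (n - 1)).hasDerivAt (dirichlet x i))
        (left_ne_zero_of_mul (derivative_charPoly_mul_pos hx i).ne')
  choose g hg hgx hg0 using hroot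
  have hcd : ContDiffAt ℝ ∞ (fun y i => g i y) x := contDiffAt_pi.2 hg
  have hmono : ∀ᶠ y in nhds x, StrictMono fun i => g i y := by
    have hgfun : (fun i => g i x) = dirichlet x := funext hgx
    refine hcd.continuousAt.eventually (isOpen_setOf_strictMono.mem_nhds ?_)
    simpa only [hgfun, Set.mem_ofPred_eq] using dirichlet_strictMono hx
  refine hcd.congr_of_eventuallyEq ?_
  filter_upwards [hmono, Filter.eventually_all.2 hg0,
    (isOpen_positiveRegion n).mem_nhds hx] with y hy hy0 hpos
  exact dirichlet_eq_of_eval_eq_zero hpos hy hy0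

theorem contDiffAt_floquetMap (hx : x ∈ positiveRegion n) : ContDiffAt ℝ ∞ floquetMap x := by
  have hd := contDiffAt_dirichlet hx
  refine ContDiffAt.prodMk (contDiffAt_pi.2 fun i => ?_) hd
  have hlog := (contDiffAt_leadingConst hx).log (leadingConst_pos hx).ne' |>.add
    ((contDiffAt_eval_charPoly contDiffAt_id (contDiffAt_pi.1 hd i) (n - 2)).log
      (right_ne_zero_of_mul (derivative_charPoly_mul_pos hx i).ne')) |>.neg
  refine hlog.congr_of_eventuallyEq ?_
  filter_upwards [(isOpen_positiveRegion n).mem_nhds hx] with y hy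
  exact floquetMap_fst hy i

end Smooth

/-! ### The differential of the Floquet map -/

section Differential

variable {n : ℕ} {x : Flaschka n}

/-- The differential `da_j / a_j` of `log a_j` at `x`, on the vector `u`. -/
noncomputable def logDerivA (x u : Flaschka n) (j : ℕ) : ℝ := u.2 j / x.2 j

/-- The differential of `offDiagSq` at `x`, on the vector `u`. -/
def offDiagSqVar (x u : Flaschka n) (k : ℕ) : ℝ :=
  2 * x.2 ((k + 2 : ℕ) : ZMod n) * u.2 ((k + 2 : ℕ) : ZMod n)

/-- The differential of `charPoly` at `x`, on the vector `u`. -/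
noncomputable def charPolyVar (x u : Flaschka n) (k : ℕ) : ℝ[X] :=
  jacobiVar (diag x) (offDiagSq x) (diag u) (offDiagSqVar x u) k

/-- The differential of `log (leadingConst x)` at `x`, on the vector `u`. -/
noncomputable def logDerivLeadingConst (x u : Flaschka n) : ℝ :=
  logDerivA x u n - ∑ j ∈ Finset.range (n - 1), logDerivA x u (j + 1)

theorem offDiagSqVar_div (hx : x ∈ positiveRegion n) (u : Flaschka n) (k : ℕ) :
    offDiagSqVar x u k / offDiagSq x k = 2 * logDerivA x u (k + 2) := by
  have := (hx ((k + 2 : ℕ) : ZMod n)).ne'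
  rw [offDiagSqVar, offDiagSq, logDerivA]
  field_simp

theorem hasDerivAt_line_fst (x u : Flaschka n) (i : ZMod n) :
    HasDerivAt (fun t : ℝ => (x + t • u).1 i) (u.1 i) 0 := by
  simpa using ((hasDerivAt_id (0 : ℝ)).mul_const (u.1 i)).const_add (x.1 i)

theorem hasDerivAt_line_snd (x u : Flaschka n) (i : ZMod n) :
    HasDerivAt (fun t : ℝ => (x + t • u).2 i) (u.2 i) 0 := by
  simpa using ((hasDerivAt_id (0 : ℝ)).mul_const (u.2 i)).const_add (x.2 i)

theorem hasDerivAt_line_log_snd (hx : x ∈ positiveRegion n) (u : Flaschka n) (j : ℕ) :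
    HasDerivAt (fun t : ℝ => Real.log ((x + t • u).2 (j : ZMod n))) (logDerivA x u j) 0 := by
  simpa [logDerivA] using
    (hasDerivAt_line_snd x u j).log (by simpa using (hx (j : ZMod n)).ne')

variable [NeZero n]

theorem eventually_line_mem (hx : x ∈ positiveRegion n) (u : Flaschka n) :
    ∀ᶠ t : ℝ in nhds 0, x + t • u ∈ positiveRegion n := by
  have hc : Continuous fun t : ℝ => x + t • u := by fun_prop
  exact hc.continuousAt.eventually ((isOpen_positiveRegion n).mem_nhds (by simpa using hx))

theorem hasDerivAt_line_floquetMap (hx : x ∈ positiveRegion n) (u : Flaschka n) :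
    HasDerivAt (fun t : ℝ => floquetMap (x + t • u)) (fderiv ℝ floquetMap x u) 0 :=
  ((contDiffAt_floquetMap hx).differentiableAt (by simp)).hasFDerivAt.hasLineDerivAt u

theorem hasDerivAt_line_eval_charPoly (hx : x ∈ positiveRegion n) (u : Flaschka n)
    (i : Fin (n - 1)) (k : ℕ) :
    HasDerivAt (fun t : ℝ => (charPoly (x + t • u) k).eval (dirichlet (x + t • u) i))
      ((charPolyVar x u k).eval (dirichlet x i) +
        (derivative (charPoly x k)).eval (dirichlet x i) * (fderiv ℝ floquetMap x u).2 i) 0 := by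
  have hsq (k : ℕ) : HasDerivAt (fun t : ℝ => offDiagSq (x + t • u) k) (offDiagSqVar x u k) 0 := by
    simpa [offDiagSqVar, offDiagSq] using
      (hasDerivAt_line_snd x u ((k + 2 : ℕ) : ZMod n)).fun_pow 2
  have hdir : HasDerivAt (fun t : ℝ => dirichlet (x + t • u) i) ((fderiv ℝ floquetMap x u).2 i) 0 :=
    hasDerivAt_pi.1 (hasDerivAt_line_floquetMap hx u).snd i
  simpa only [zero_smul, add_zero, charPoly, charPolyVar] using
    hasDerivAt_eval_jacobiPoly (β := fun t => diag (x + t • u)) (β' := diag u)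
      (fun _ => hasDerivAt_line_fst x u _) hsq hdir k

theorem hasDerivAt_line_log_leadingConst (hx : x ∈ positiveRegion n) (u : Flaschka n) :
    HasDerivAt (fun t : ℝ => Real.log (leadingConst (x + t • u))) (logDerivLeadingConst x u) 0 := by
  have h := (hasDerivAt_line_log_snd hx u n).sub
    (HasDerivAt.fun_sum (u := Finset.range (n - 1)) fun j _ =>
      hasDerivAt_line_log_snd hx u (j + 1))
  refine h.congr_of_eventuallyEq ?_
  filter_upwards [eventually_line_mem hx u] with t ht
  rw [leadingConst, Real.log_div (ht 0).ne' (prodA_pos ht _).ne', prodA,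
    Real.log_prod fun j _ => (ht _).ne', Pi.sub_apply, ZMod.natCast_self]

theorem fderiv_floquetMap_snd (hx : x ∈ positiveRegion n) (u : Flaschka n) (i : Fin (n - 1)) :
    (fderiv ℝ floquetMap x u).2 i = -((charPolyVar x u (n - 1)).eval (dirichlet x i) /
      (derivative (charPoly x (n - 1))).eval (dirichlet x i)) := by
  have hzero : HasDerivAt
      (fun t : ℝ => (charPoly (x + t • u) (n - 1)).eval (dirichlet (x + t • u) i)) 0 0 := by
    refine (hasDerivAt_const (0 : ℝ) (0 : ℝ)).congr_of_eventuallyEq ?_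
    filter_upwards [eventually_line_mem hx u] with t ht
    exact eval_charPoly_dirichlet ht i
  have hne := left_ne_zero_of_mul (derivative_charPoly_mul_pos hx i).ne'
  have := (hasDerivAt_line_eval_charPoly hx u i (n - 1)).unique hzero
  field_simp
  linarith

theorem fderiv_floquetMap_fst (hx : x ∈ positiveRegion n) (u : Flaschka n) (i : Fin (n - 1)) :
    (fderiv ℝ floquetMap x u).1 i =
      -(logDerivLeadingConst x u + ((charPolyVar x u (n - 2)).eval (dirichlet x i) +
          (derivative (charPoly x (n - 2))).eval (dirichlet x i) * (fderiv ℝ floquetMap x u).2 i) /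
        (charPoly x (n - 2)).eval (dirichlet x i)) := by
  have hf := hasDerivAt_pi.1 (hasDerivAt_line_floquetMap hx u).fst i
  have hne := right_ne_zero_of_mul (derivative_charPoly_mul_pos hx i).ne'
  have hlog := (hasDerivAt_line_eval_charPoly hx u i (n - 2)).log (by simpa using hne)
  simp only [zero_smul, add_zero] at hlog
  refine hf.unique
    (((hasDerivAt_line_log_leadingConst hx u).add hlog).neg.congr_of_eventuallyEq ?_)
  filter_upwards [eventually_line_mem hx u] with t ht
  exact floquetMap_fst ht i

theorem fderiv_floquetMap_wedge (hx : x ∈ positiveRegion n) (u v : Flaschka n)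
    (i : Fin (n - 1)) :
    (fderiv ℝ floquetMap x u).2 i * (fderiv ℝ floquetMap x v).1 i -
        (fderiv ℝ floquetMap x v).2 i * (fderiv ℝ floquetMap x u).1 i =
      logDerivLeadingConst x v * ((charPolyVar x u (n - 1)).eval (dirichlet x i) /
          (derivative (charPoly x (n - 1))).eval (dirichlet x i)) -
        logDerivLeadingConst x u * ((charPolyVar x v (n - 1)).eval (dirichlet x i) /
          (derivative (charPoly x (n - 1))).eval (dirichlet x i)) +
        (charPolyVar x u (n - 1) * charPolyVar x v (n - 2) -
            charPolyVar x v (n - 1) * charPolyVar x u (n - 2)).eval (dirichlet x i) /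
          ((derivative (charPoly x (n - 1))).eval (dirichlet x i) *
            (charPoly x (n - 2)).eval (dirichlet x i)) := by
  have hd := left_ne_zero_of_mul (derivative_charPoly_mul_pos hx i).ne'
  have hq := right_ne_zero_of_mul (derivative_charPoly_mul_pos hx i).ne'
  rw [fderiv_floquetMap_fst hx, fderiv_floquetMap_fst hx, fderiv_floquetMap_snd hx,
    fderiv_floquetMap_snd hx, eval_sub, eval_mul, eval_mul]
  field_simp
  ring

theorem sum_dirichlet (hx : x ∈ positiveRegion n) (F : ℝ → ℝ) :
    ∑ i, F (dirichlet x i) = ∑ r ∈ jacobiRoots (diag x) (offDiagSq x) (n - 1), F r := by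
  rw [← image_dirichlet hx, Finset.sum_image (dirichlet_strictMono hx).injective.injOn]

theorem sum_charPolyVar_div (hx : x ∈ positiveRegion n) (u : Flaschka n) :
    ∑ i, (charPolyVar x u (n - 1)).eval (dirichlet x i) /
        (derivative (charPoly x (n - 1))).eval (dirichlet x i) =
      -∑ j ∈ Finset.range (n - 1), diag u j := by
  rw [sum_dirichlet hx fun r =>
    (charPolyVar x u (n - 1)).eval r / (derivative (charPoly x (n - 1))).eval r]
  rcases n - 1 with _ | k
  · simp [jacobiRoots, jacobiPoly]
  · exact sum_jacobiVar_div (offDiagSq_pos hx) k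

theorem sum_charPolyVar_det_div (hx : x ∈ positiveRegion n) (u v : Flaschka n) :
    ∑ i, (charPolyVar x u (n - 1) * charPolyVar x v (n - 2) -
          charPolyVar x v (n - 1) * charPolyVar x u (n - 2)).eval (dirichlet x i) /
        ((derivative (charPoly x (n - 1))).eval (dirichlet x i) *
          (charPoly x (n - 2)).eval (dirichlet x i)) =
      2 * ∑ i ∈ Finset.range (n - 2),
        (logDerivA x u (i + 2) * ∑ j ∈ Finset.range (i + 1), diag v j -
          logDerivA x v (i + 2) * ∑ j ∈ Finset.range (i + 1), diag u j) := by
  rw [sum_dirichlet hx fun r => (charPolyVar x u (n - 1) * charPolyVar x v (n - 2) -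
      charPolyVar x v (n - 1) * charPolyVar x u (n - 2)).eval r /
    ((derivative (charPoly x (n - 1))).eval r * (charPoly x (n - 2)).eval r)]
  have hn : n - 2 = n - 1 - 1 := by omega
  rw [hn]
  rcases n - 1 with _ | k
  · simp [jacobiRoots, jacobiPoly]
  refine (residueSum_eq (offDiagSq_pos hx) k).trans ?_
  simp only [offDiagSqVar_div hx, mul_assoc, ← mul_sub, ← Finset.mul_sum, Nat.add_sub_cancel]

theorem logDerivLeadingConst_eq {u : Flaschka n}
    (hu : ∑ j ∈ Finset.range n, logDerivA x u (j + 1) = 0) :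
    logDerivLeadingConst x u = 2 * logDerivA x u n := by
  have hn := Nat.sub_add_cancel (NeZero.one_le (n := n))
  have h := Finset.sum_range_succ (fun j => logDerivA x u (j + 1)) (n - 1)
  rw [hn, hu] at h
  rw [logDerivLeadingConst]
  linarith

theorem sum_fderiv_floquetMap_wedge (hx : x ∈ positiveRegion n) {u v : Flaschka n}
    (hu : ∑ j ∈ Finset.range n, logDerivA x u (j + 1) = 0)
    (hv : ∑ j ∈ Finset.range n, logDerivA x v (j + 1) = 0) :
    ∑ i, ((fderiv ℝ floquetMap x u).2 i * (fderiv ℝ floquetMap x v).1 i -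
        (fderiv ℝ floquetMap x v).2 i * (fderiv ℝ floquetMap x u).1 i) =
      2 * ∑ i ∈ Finset.range (n - 1),
        (logDerivA x u (i + 2) * ∑ j ∈ Finset.range (i + 1), diag v j -
          logDerivA x v (i + 2) * ∑ j ∈ Finset.range (i + 1), diag u j) := by
  simp only [fderiv_floquetMap_wedge hx]
  rw [Finset.sum_add_distrib, Finset.sum_sub_distrib, ← Finset.mul_sum, ← Finset.mul_sum,
    sum_charPolyVar_div hx, sum_charPolyVar_div hx, sum_charPolyVar_det_div hx,
    logDerivLeadingConst_eq hu, logDerivLeadingConst_eq hv]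
  obtain hn | ⟨k, hn⟩ : n = 1 ∨ ∃ k, n = k + 2 := by
    rcases n with _ | _ | k
    exacts [absurd rfl (NeZero.ne 0), .inl rfl, .inr ⟨k, rfl⟩]
  · have h1 : n - 1 = 0 := by omega
    have h2 : n - 2 = 0 := by omega
    simp [h1, h2]
  · have h1 : n - 1 = k + 1 := by omega
    have h2 : n - 2 = k := by omega
    have hlog (w : Flaschka n) : logDerivA x w n = logDerivA x w (k + 2) := congrArg _ hn
    simp only [h1, h2, hlog, Finset.sum_range_succ _ k]
    ring

theorem sum_Icc_mul_logDerivA {v : Flaschka n} (u : Flaschka n)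
    (hv : ∑ j ∈ Finset.range n, logDerivA x v (j + 1) = 0) :
    ∑ i ∈ Finset.Icc 2 n, ∑ j ∈ Finset.Icc 1 (i - 1), u.1 (i : ZMod n) * logDerivA x v j =
      -∑ i ∈ Finset.range (n - 1),
        logDerivA x v (i + 2) * ∑ j ∈ Finset.range (i + 1), diag u j := by
  have h := sum_Icc_add_sum_range (logDerivA x v) (fun i => u.1 (i : ZMod n)) (n - 1)
  rw [Nat.sub_add_cancel (NeZero.one_le (n := n)), hv, mul_zero] at h
  exact eq_neg_of_add_eq_zero_left h

theorem sum_logDerivA_eq_zero {α : ℝ} (hx : x ∈ phaseSpace n α) {u : Flaschka n}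
    (hu : u ∈ tangentConeAt ℝ (phaseSpace n α) x) :
    ∑ j ∈ Finset.range n, logDerivA x u (j + 1) = 0 := by
  let F (y : Flaschka n) : ℝ := ∑ j ∈ Finset.range n, Real.log (y.2 ((j + 1 : ℕ) : ZMod n))
  have hp := phaseSpace_subset n α hx
  have hd : DifferentiableAt ℝ F x := DifferentiableAt.fun_sum fun j _ =>
    ((contDiff_flaschka_snd _).contDiffAt.differentiableAt (by simp)).log (hp _).ne'
  have hconst : ∀ y ∈ phaseSpace n α, F y = Real.log (α ^ n) := by
    intro y hy
    rw [← hy.2.2, prod_zmod_eq_prod_range, Real.log_prod fun j _ => (hy.1 _).ne']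
  have hzero : HasFDerivWithinAt F (0 : Flaschka n →L[ℝ] ℝ) (phaseSpace n α) x :=
    (hasFDerivWithinAt_const _ _ _).congr hconst (hconst x hx)
  have hline := hd.hasFDerivAt.hasLineDerivAt u
  rw [hd.hasFDerivAt.hasFDerivWithinAt.unique_on hzero hu] at hline
  exact (HasDerivAt.fun_sum (u := Finset.range n)
    fun j _ => hasDerivAt_line_log_snd hp u (j + 1)).unique hline

end Differential

/-! ### The symplectic form and its primitive -/

section Forms

variable {n : ℕ}

theorem stdForm_apply (z : Target n) (v : Fin 2 → Target n) :
    stdForm n z v = ∑ i, ((v 0).2 i * (v 1).1 i - (v 1).2 i * (v 0).1 i) := by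
  rw [stdForm, ContinuousAlternatingMap.sum_apply]
  exact Finset.sum_congr rfl fun i _ => wedge_apply _ _ _

theorem actionForm_apply (z : Target n) (v : Fin 1 → Target n) :
    actionForm n z v = ∑ i, z.1 i * (v 0).2 i := by
  rw [actionForm, oneForm_apply]
  simp [dμ]

theorem contDiff_actionForm (n : ℕ) : ContDiff ℝ ∞ (actionForm n) :=
  (ContinuousAlternatingMap.ofSubsingletonLIE (E := Target n) (F := ℝ) (0 : Fin 1)).contDiff.comp
    (ContDiff.sum fun i _ => ((contDiff_apply ℝ ℝ i).comp contDiff_fst).smul contDiff_const)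

theorem extDeriv_actionForm (z : Target n) : extDeriv (actionForm n) z = -stdForm n z := by
  ext v
  have hd : DifferentiableAt ℝ (actionForm n) z :=
    (contDiff_actionForm n).contDiffAt.differentiableAt (by simp)
  have hf (w : Fin 1 → Target n) (y : Target n) :
      fderiv ℝ (fun z => actionForm n z w) z y = ∑ i, y.1 i * (w 0).2 i := by
    have : HasFDerivAt (fun z => actionForm n z w) (∑ i, (w 0).2 i • df n i) z := by
      simp only [actionForm_apply]
      exact HasFDerivAt.fun_sum fun i _ => (df n i).hasFDerivAt.mul_const ((w 0).2 i)
    rw [this.fderiv]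
    simp [df, mul_comm]
  rw [extDeriv_apply hd, Fin.sum_univ_two, hf, hf, ContinuousAlternatingMap.neg_apply,
    stdForm_apply, ← Finset.sum_neg_distrib]
  simp only [Fin.val_zero, pow_zero, one_smul, Fin.val_one, pow_one, neg_smul, ← sub_eq_add_neg,
    ← Finset.sum_sub_distrib]
  refine Finset.sum_congr rfl fun i _ => ?_
  change (v 0).1 i * (v 1).2 i - (v 1).1 i * (v 0).2 i = _
  ring

variable [NeZero n] {α : ℝ} {x : Flaschka n}

theorem todaForm_apply (x : Flaschka n) (v : Fin 2 → Flaschka n) :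
    todaForm n x v = 2 * ∑ i ∈ Finset.Icc 2 n, ∑ j ∈ Finset.Icc 1 (i - 1),
      ((v 0).1 (i : ZMod n) * logDerivA x (v 1) j -
        (v 1).1 (i : ZMod n) * logDerivA x (v 0) j) := by
  simp only [todaForm, ContinuousAlternatingMap.smul_apply, ContinuousAlternatingMap.sum_apply,
    smul_eq_mul, wedge_apply, logDerivA, div_eq_inv_mul]
  rfl

theorem stdForm_fderiv_floquetMap (hx : x ∈ phaseSpace n α) {v : Fin 2 → Flaschka n}
    (hv : ∀ i, v i ∈ tangentConeAt ℝ (phaseSpace n α) x) (z : Target n) :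
    stdForm n z (fun i => fderiv ℝ floquetMap x (v i)) = todaForm n x v := by
  have hv₀ := sum_logDerivA_eq_zero hx (hv 0)
  have hv₁ := sum_logDerivA_eq_zero hx (hv 1)
  simp only [stdForm_apply, todaForm_apply, Finset.sum_sub_distrib]
  rw [← Finset.sum_sub_distrib,
    sum_fderiv_floquetMap_wedge (phaseSpace_subset n α hx) hv₀ hv₁,
    sum_Icc_mul_logDerivA _ hv₀, sum_Icc_mul_logDerivA _ hv₁, Finset.sum_sub_distrib]
  ring

theorem pullbackForm_stdForm (hx : x ∈ phaseSpace n α) :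
    FormEqAt (phaseSpace n α) x (pullbackForm floquetMap (phaseSpace n α) (stdForm n) x)
      (todaForm n x) := by
  have hd := (contDiffAt_floquetMap (phaseSpace_subset n α hx)).differentiableAt (by simp)
  exact fun v hv => (pullbackForm_formEqAt hd (stdForm n) v hv).trans
    (stdForm_fderiv_floquetMap hx hv (floquetMap x))

theorem isPrimitiveOn_neg_actionForm (α : ℝ) :
    IsPrimitiveOn (phaseSpace n α)
      (fun x => -pullbackForm floquetMap (phaseSpace n α) (actionForm n) x) (todaForm n) := by
  have hext : extDeriv (fun z => -actionForm n z) = stdForm n := by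
    funext z
    change extDeriv (-actionForm n) z = stdForm n z
    rw [← neg_one_smul ℝ (actionForm n), extDeriv_smul, extDeriv_actionForm, neg_one_smul, neg_neg]
  have hprim := isPrimitiveOn_pullbackForm (isOpen_positiveRegion n) (phaseSpace_subset n α)
    (fun x hx => (contDiffAt_floquetMap hx).contDiffWithinAt) (contDiff_actionForm n).neg
  rw [hext] at hprim
  exact hprim.congr fun x hx => pullbackForm_stdForm hx

end Forms

end Toda

theorem theorem3p2 (n : ℕ) [NeZero n] (α : ℝ) (hα : 0 < α) :
    -- the data are well defined: `y₁(n+1, ·)` has degree `n - 1`, all its roots are real and they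
    -- are the `μ_i`, and `y₂(n+1, μ_i) ≠ 0`
    (∀ x ∈ Toda.phaseSpace n α,
      (Toda.y₁ x (n + 1)).natDegree = n - 1 ∧
      (Toda.y₁ x (n + 1)).roots = Finset.univ.val.map (Toda.dirichlet x) ∧
      ∀ i, (Toda.y₂ x (n + 1)).eval (Toda.dirichlet x i) ≠ 0) ∧
    -- the image
    Toda.floquetMap '' Toda.phaseSpace n α = {z : Toda.Target n | StrictMono z.2} ∧
    -- the symplectomorphism
    IsSymplectomorphismOn Toda.floquetMap (Toda.phaseSpace n α) (Toda.todaForm n)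
      (Toda.floquetMap '' Toda.phaseSpace n α) (Toda.stdForm n) ∧
    -- the primitive
    IsPrimitiveOn (Toda.phaseSpace n α)
      (fun x => -pullbackForm Toda.floquetMap (Toda.phaseSpace n α) (Toda.actionForm n) x)
      (Toda.todaForm n) := by
  refine ⟨fun x hx => ?_, Toda.floquetMap_image hα, ⟨?_, ?_, ?_, ?_⟩,
    Toda.isPrimitiveOn_neg_actionForm α⟩
  · have hpos := Toda.phaseSpace_subset n α hx
    exact ⟨Toda.natDegree_y₁_succ hpos, Toda.roots_y₁_succ hpos,
      Toda.eval_y₂_dirichlet_ne_zero hpos⟩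
  · exact Toda.floquetMap_injOn.bijOn_image
  · exact smoothOnSubset_of_contDiffOn (Toda.isOpen_positiveRegion n)
      (Toda.phaseSpace_subset n α) fun x hx => (Toda.contDiffAt_floquetMap hx).contDiffWithinAt
  · rw [Toda.floquetMap_image hα]
    exact ⟨Toda.inverseMap n α, Toda.inverseMap_invOn hα,
      smoothOnSubset_of_contDiffOn (Toda.isOpen_orderedRegion n) subset_rfl
        fun z hz => (Toda.contDiffAt_inverseMap hα hz).contDiffWithinAt⟩
  · exact fun x hx => Toda.pullbackForm_stdForm hx
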